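/- Let $K=\mathbb{Q}(\theta)$ be a number field generated by a root $\theta$ of a monic irreducible polynomial $F(x)=x^n+ax^m+b\in\mathbb{Z}[x]$ with integers $0\le m<n$. Let $\mathbb{Z}_K$ be the ring of integers of $K$, and let $$i(K)=\gcd\{(\mathbb{Z}_K:\mathbb{Z}[\alpha]) \;:\; \alpha\in\mathbb{Z}_K,\ K=\mathbb{Q}(\alpha)\}.$$ Call $K$ monogenic if $\mathbb{Z}_K$ has a $\mathbb{Z}$-basis of the form $(1,\alpha,\dots,\alpha^{n-1})$ for some $\alpha\in\mathbb{Z}_K$. For a prime $p$, let $\nu_p$ be the $p$-adic valuation on $\mathbb{Z}$, with $\nu_p(0)=\infty$. For positive integers $f,s$ and $t\in\mathbb{Z}$, let $N_p(f)$ be the number of monic irreducible polynomials of degree $f$ in $\mathbb{F}_p[x]$, and let $N_p(f,s,t)$ be the number of monic irreducible factors of degree $f$ of $x^s+\overline{t}$ in $\mathbb{F}_p[x]$. Let $p$ be an odd prime which divides both $a$ and $n$ and does not divide $b$. Put $\mu=\nu_p(a)$, $\nu=\nu_p(b^{p-1}-1)$, and write $n=s\,p^r$ with $p\nmid s$. Suppose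 that for some positive integer $f$ one of the following conditions holds: 1. $\mu<\min\{\nu,r+1\}$ and $N_p(f)<\mu\,N_p(f,s,b)$; 2. $\nu<\min\{\mu,r+1\}$ and $N_p(f)<\nu\,N_p(f,s,b)$; 3. $r+1\le\min\{\nu,\mu\}$ and $N_p(f)<(r+1)\,N_p(f,s,b)$. Then $p$ divides $i(K)$. In particular, $K$ is not monogenic. -/

import Mathlib

open Polynomial NumberField

/-- The index `(ℤ_K : ℤ[θ])` of an algebraic integer `θ` of `K`
(it is a positive integer whenever `K = ℚ(θ)`). -/
noncomputable def elementIndex (K : Type*) [Field K] (θ : 𝓞 K) : ℕ :=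
  (Subalgebra.toSubmodule (Algebra.adjoin ℤ {θ})).toAddSubgroup.index

/-- The set of the indices `(ℤ_K : ℤ[θ])`, where `θ` runs over the algebraic integers of `K`
with `K = ℚ(θ)`. -/
def primitiveIndices (K : Type*) [Field K] [NumberField K] : Set ℕ :=
  {k | ∃ θ : 𝓞 K, IntermediateField.adjoin ℚ {(θ : K)} = ⊤ ∧ k = elementIndex K θ}

/-- The index `i(K)` of a number field: the greatest common divisor of the indices of the integral
primitive elements, obtained as the nonnegative generator of the ideal of `ℤ` they generate. -/
noncomputable def fieldIndex (K : Type*) [Field K] [NumberField K] : ℕ :=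
  (Submodule.IsPrincipal.generator
    (Ideal.span ((fun k : ℕ => (k : ℤ)) '' primitiveIndices K))).natAbs

/-- `i(K)` has the universal property of the greatest common divisor. -/
theorem dvd_fieldIndex_iff (K : Type*) [Field K] [NumberField K] (d : ℕ) :
    d ∣ fieldIndex K ↔ ∀ θ : 𝓞 K, IntermediateField.adjoin ℚ {(θ : K)} = ⊤ →
      d ∣ elementIndex K θ := by
  unfold fieldIndex
  rw [← Int.natCast_dvd, ← Ideal.mem_span_singleton, ← Ideal.span_singleton_le_iff_mem,
    Ideal.span_singleton_generator, Ideal.span_le]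
  constructor
  · intro h θ hθ
    have := h (Set.mem_image_of_mem _ (⟨θ, hθ, rfl⟩ : elementIndex K θ ∈ primitiveIndices K))
    rw [SetLike.mem_coe, Ideal.mem_span_singleton] at this
    exact_mod_cast this
  · rintro h _ ⟨_, ⟨θ, hθ, rfl⟩, rfl⟩
    rw [SetLike.mem_coe, Ideal.mem_span_singleton]
    exact Int.natCast_dvd_natCast.mpr (h θ hθ)

/-- `K` is monogenic: `ℤ_K` has a `ℤ`-basis `(1, α, …, α ^ (n - 1))` with `n = [K : ℚ]`. -/
def IsMonogenicField (K : Type*) [Field K] [NumberField K] : Prop :=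
  ∃ (α : 𝓞 K) (B : Module.Basis (Fin (Module.finrank ℚ K)) ℤ (𝓞 K)), ∀ i, B i = α ^ (i : ℕ)

/-- `N_p(f)`: the number of monic irreducible polynomials of degree `f` over `𝔽_p`. -/
noncomputable def numIrreducible (p f : ℕ) : ℕ :=
  {q : (ZMod p)[X] | q.Monic ∧ Irreducible q ∧ q.natDegree = f}.ncard

/-- `N_p(f, s, t)`: the number of monic irreducible factors of degree `f` of `x ^ s + t`
over `𝔽_p`. -/
noncomputable def numIrreducibleFactors (p f s : ℕ) (t : ℤ) : ℕ :=
  {q : (ZMod p)[X] | q.Monic ∧ Irreducible q ∧ q.natDegree = f ∧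
    q ∣ X ^ s + C (t : ZMod p)}.ncard

/-! If p does not divide the index of α, Dedekind–Kummer matches the primes above p with the
irreducible factors modulo p of the minimal polynomial of α, degree for degree. So at most N_p(f)
primes have residue degree f (`card_le_numIrreducible`), and it suffices to exhibit (k + 1) N_p(f,
s, b) of them, where k + 1 is μ, ν or r + 1 in the three cases.

From here on the coefficients are also written A and B, and a stands for r - k. Let ζ be a root of
x^s + B in an algebraic closure of ℚ_p. Then F(x + ζ) has constant term (B - B^(p^r)) + A ζ^m, of
valuation k + 1 (at least k + 1 in the third case), while n.choose (p^j) has valuation r - j. Hence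
the part of its Newton polygon above 0, …, p^r has k + 1 sides of height one, with lengths p^a, p^a
(p - 1), p^(a+1) (p - 1), … (`exists_root_hasSlope`, `exists_root_trinomial`); only the first may be
steeper, when a = 0.

A root w of F on a side of length l embeds K and so defines a prime P. The value |θ^s + B| = |w - ζ|
forces e(P) ≥ l, and if ζ reduces to a root of an irreducible factor q of x^s + B, then f(P) ≥ deg q
(`exists_prime_of_factor`). P determines q and, the lengths being distinct, the side. The products l
· deg q add up to s p^r = n, which bounds ∑ e f, so f(P) = deg q throughout
(`exists_primes_of_inertiaDeg`). -/

/-! ### Indices of generators and the number of primes above p -/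

theorem exponent_dvd_elementIndex (K : Type*) [Field K] [NumberField K] (α : 𝓞 K) :
    RingOfIntegers.exponent α ∣ elementIndex K α := by
  have hmem : ((elementIndex K α : ℤ)) ∈ Ideal.under ℤ (conductor ℤ α) := by
    rw [Ideal.mem_comap, mem_conductor_iff]
    intro x
    -- The index annihilates the quotient of the ring of integers by ℤ[α], so it lies in the
    -- conductor.
    have := AddSubgroup.nsmul_index_mem
      (Subalgebra.toSubmodule (Algebra.adjoin ℤ {α})).toAddSubgroup x
    simpa [nsmul_eq_mul, elementIndex] using this
  rw [← Int.ideal_span_absNorm_eq_self (Ideal.under ℤ (conductor ℤ α)),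
    Ideal.mem_span_singleton] at hmem
  exact_mod_cast hmem

open scoped Classical in
/-- If `p` does not divide the index of `α`, there are at most `N_p(f)` primes of residue degree
`f` above `p`. -/
theorem card_le_numIrreducible {K : Type*} [Field K] [NumberField K] {p : ℕ} [Fact p.Prime]
    {α : 𝓞 K} (hα : ¬ p ∣ elementIndex K α) {f : ℕ}
    (T : Finset (Ideal (𝓞 K)))
    (hT : ∀ P ∈ T, P ∈ Ideal.primesOver (Ideal.span {(p : ℤ)}) (𝓞 K) ∧ P.inertiaDeg ℤ = f) :
    T.card ≤ numIrreducible p f := by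
  have hexp : ¬ p ∣ RingOfIntegers.exponent α :=
    fun h => hα (h.trans (exponent_dvd_elementIndex K α))
  let e := NumberField.Ideal.primesOverSpanEquivMonicFactorsMod hexp
  have hfin : {q : (ZMod p)[X] | q.Monic ∧ Irreducible q ∧ q.natDegree = f}.Finite := by
    refine Set.Finite.subset (s := {q : (ZMod p)[X] | q.natDegree < f + 1}) ?_ ?_
    · have : Finite (Polynomial.degreeLT (ZMod p) (f + 1)) :=
        Finite.of_equiv _ (Polynomial.degreeLTEquiv (ZMod p) (f + 1)).toEquiv.symm
      refine Set.Finite.subset (Set.toFinite (Polynomial.degreeLT (ZMod p) (f + 1) : Set _)) ?_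
      intro q hq
      rw [SetLike.mem_coe, Polynomial.mem_degreeLT]
      exact (Polynomial.degree_le_natDegree).trans_lt (by exact_mod_cast hq)
    · rintro q ⟨-, -, hq⟩
      simp [hq]
  rw [numIrreducible, ← Set.ncard_coe_finset]
  refine Set.ncard_le_ncard_of_injOn
    -- The value 0 is a dummy: every member of `T` lies above p.
    (fun P => if h : P ∈ Ideal.primesOver (Ideal.span {(p : ℤ)}) (𝓞 K) then (e ⟨P, h⟩ : (ZMod p)[X])
      else 0) ?_ ?_ hfin
  · intro P hP
    obtain ⟨h1, h2⟩ := hT P hP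
    have hne : map (Int.castRingHom (ZMod p)) (minpoly ℤ α) ≠ 0 :=
      map_monic_ne_zero (minpoly.monic α.isIntegral)
    have hmem := (e ⟨P, h1⟩).2
    have hmem' := hmem
    rw [Multiset.mem_toFinset, Polynomial.mem_normalizedFactors_iff hne] at hmem'
    have hd := NumberField.Ideal.inertiaDeg_primesOverSpanEquivMonicFactorsMod_symm_apply' hexp hmem
    simp only [h1, dif_pos]
    refine ⟨hmem'.2.1, hmem'.1, ?_⟩
    rw [← hd, ← h2]
    congr 1
    exact congrArg Subtype.val (e.symm_apply_apply ⟨P, h1⟩)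
  · intro P hP P' hP' h
    have h1 := (hT P hP).1
    have h1' := (hT P' hP').1
    simp only [h1, h1', dif_pos] at h
    exact congrArg Subtype.val (e.injective (Subtype.ext h))

theorem elementIndex_eq_one_of_basis {K : Type*} [Field K] [NumberField K] {α : 𝓞 K} {N : ℕ}
    (B : Module.Basis (Fin N) ℤ (𝓞 K)) (hB : ∀ i, B i = α ^ (i : ℕ)) :
    elementIndex K α = 1 := by
  have : Subalgebra.toSubmodule (Algebra.adjoin ℤ {α}) = ⊤ := by
    rw [eq_top_iff, ← B.span_eq, Submodule.span_le]
    rintro _ ⟨i, rfl⟩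
    rw [hB]
    exact pow_mem (Algebra.self_mem_adjoin_singleton ℤ α) _
  simp [elementIndex, this]

theorem adjoin_eq_top_of_basis {K : Type*} [Field K] [NumberField K] {α : 𝓞 K} {N : ℕ}
    (B : Module.Basis (Fin N) ℤ (𝓞 K)) (hB : ∀ i, B i = α ^ (i : ℕ)) :
    IntermediateField.adjoin ℚ {(α : K)} = ⊤ := by
  rw [eq_top_iff]
  intro x _
  have hint : ∀ y : 𝓞 K, (y : K) ∈ IntermediateField.adjoin ℚ {(α : K)} := by
    intro y
    rw [← B.sum_repr y]
    simp only [map_sum, zsmul_eq_mul, map_mul, map_intCast, hB, map_pow]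
    exact sum_mem fun i _ => mul_mem (intCast_mem _ _)
      (pow_mem (IntermediateField.mem_adjoin_simple_self ℚ _) _)
  obtain ⟨a, b, -, rfl⟩ := IsFractionRing.div_surjective (A := 𝓞 K) x
  exact div_mem (hint a) (hint b)

theorem not_isMonogenicField_of_dvd_fieldIndex {K : Type*} [Field K] [NumberField K] {p : ℕ}
    (hp : p.Prime) (h : p ∣ fieldIndex K) : ¬ IsMonogenicField K := by
  rintro ⟨α, B, hB⟩
  have := (dvd_fieldIndex_iff K p).mp h α (adjoin_eq_top_of_basis B hB)
  rw [elementIndex_eq_one_of_basis B hB] at this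
  exact hp.one_lt.ne' (Nat.dvd_one.mp this)

/-! ### Primes cut out by an embedding into an ultrametric field -/

section ultrametric

variable {Ω : Type*} [NormedField Ω] [IsUltrametricDist Ω]

theorem norm_le_one_of_isIntegral {x : Ω} (hx : IsIntegral ℤ x) : ‖x‖ ≤ 1 := by
  obtain ⟨f, hf, h0⟩ := hx
  by_contra! h
  rw [← aeval_def, aeval_eq_sum_range, Finset.sum_range_succ, hf.coeff_natDegree, one_smul] at h0
  have hpos : 0 < f.natDegree := by
    rcases Nat.eq_zero_or_pos f.natDegree with h' | h'
    · simp [h'] at h0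
    · exact h'
  have hle : ‖∑ i ∈ Finset.range f.natDegree, f.coeff i • x ^ i‖ ≤ ‖x‖ ^ (f.natDegree - 1) := by
    refine IsUltrametricDist.norm_sum_le_of_forall_le_of_nonneg (by positivity) fun i hi => ?_
    rw [zsmul_eq_mul, norm_mul, norm_pow]
    have h1 : ‖x‖ ^ i ≤ ‖x‖ ^ (f.natDegree - 1) :=
      pow_le_pow_right₀ h.le (by have := Finset.mem_range.mp hi; omega)
    calc _ ≤ 1 * ‖x‖ ^ i := by
          gcongr
          exact IsUltrametricDist.norm_intCast_le_one Ω _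
      _ ≤ _ := by rwa [one_mul]
  rw [eq_neg_of_add_eq_zero_left h0, norm_neg, norm_pow] at hle
  exact absurd hle (not_le.mpr (pow_lt_pow_right₀ h (by omega)))

theorem norm_intCast_eq_one {p : ℕ} (hp : p.Prime) (hΩ : ‖(p : Ω)‖ < 1) {z : ℤ}
    (hz : ¬ (p : ℤ) ∣ z) : ‖(z : Ω)‖ = 1 := by
  refine le_antisymm (IsUltrametricDist.norm_intCast_le_one Ω z) ?_
  by_contra! h
  have hcop : IsCoprime (p : ℤ) z :=
    (Prime.coprime_iff_not_dvd (Nat.prime_iff_prime_int.mp hp)).mpr hz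
  obtain ⟨u, v, huv⟩ := hcop
  have h1 : (u : Ω) * p + v * z = 1 := by exact_mod_cast congrArg (Int.cast (R := Ω)) huv
  have h2 : ‖(u : Ω) * p + v * z‖ < 1 := by
    refine (IsUltrametricDist.norm_add_le_max _ _).trans_lt (max_lt ?_ ?_) <;> rw [norm_mul]
    · exact (mul_le_of_le_one_left (norm_nonneg _)
        (IsUltrametricDist.norm_intCast_le_one Ω u)).trans_lt hΩ
    · exact (mul_le_of_le_one_left (norm_nonneg _)
        (IsUltrametricDist.norm_intCast_le_one Ω v)).trans_lt h
  rw [h1, norm_one] at h2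
  exact lt_irrefl _ h2

variable {R : Type*} [CommRing R]

/-- The prime ideal of `R` cut out by the open unit ball of `Ω`. -/
def normIdeal (σ : R →+* Ω) (hσ : ∀ x, ‖σ x‖ ≤ 1) : Ideal R where
  carrier := {x | ‖σ x‖ < 1}
  add_mem' {a b} ha hb := by
    simp only [Set.mem_ofPred_eq, map_add] at *
    exact (IsUltrametricDist.norm_add_le_max _ _).trans_lt (max_lt ha hb)
  zero_mem' := by simp
  smul_mem' c x hx := by
    simp only [Set.mem_ofPred_eq, smul_eq_mul, map_mul, norm_mul] at *
    exact (mul_le_of_le_one_left (norm_nonneg _) (hσ c)).trans_lt hx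

theorem mem_normIdeal {σ : R →+* Ω} {hσ : ∀ x, ‖σ x‖ ≤ 1} {x : R} :
    x ∈ normIdeal σ hσ ↔ ‖σ x‖ < 1 := Iff.rfl

theorem norm_eq_one_of_notMem {σ : R →+* Ω} {hσ : ∀ x, ‖σ x‖ ≤ 1} {x : R}
    (hx : x ∉ normIdeal σ hσ) : ‖σ x‖ = 1 :=
  le_antisymm (hσ x) (not_lt.mp hx)

instance normIdeal_isPrime (σ : R →+* Ω) (hσ : ∀ x, ‖σ x‖ ≤ 1) : (normIdeal σ hσ).IsPrime := by
  refine ⟨?_, fun {x y} h => ?_⟩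
  · rw [Ideal.ne_top_iff_one, mem_normIdeal]
    simp
  · by_contra! hxy
    rw [mem_normIdeal, map_mul, norm_mul, norm_eq_one_of_notMem hxy.1,
      norm_eq_one_of_notMem hxy.2] at h
    norm_num at h

theorem normIdeal_liesOver {p : ℕ} (hp : p.Prime) (hΩ : ‖(p : Ω)‖ < 1) (σ : R →+* Ω)
    (hσ : ∀ x, ‖σ x‖ ≤ 1) : (normIdeal σ hσ).LiesOver (Ideal.span {(p : ℤ)}) := by
  constructor
  ext z
  rw [Ideal.mem_span_singleton, Ideal.under_def, Ideal.mem_comap, mem_normIdeal]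
  simp only [algebraMap_int_eq, eq_intCast, map_intCast]
  constructor
  · rintro ⟨w, rfl⟩
    push_cast
    rw [norm_mul]
    exact (mul_le_of_le_one_right (norm_nonneg _)
      (IsUltrametricDist.norm_intCast_le_one Ω w)).trans_lt hΩ
  · intro h
    by_contra hz
    exact h.ne (norm_intCast_eq_one hp hΩ hz)

variable [IsDedekindDomain R]

theorem norm_eq_pow_multiplicity {σ : R →+* Ω}
    {hσ : ∀ x, ‖σ x‖ ≤ 1} {π : R} (hπ : π ∈ normIdeal σ hσ)
    (hπ2 : π ∉ normIdeal σ hσ ^ 2) {x : R} (hx : x ≠ 0) :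
    ‖σ x‖ = ‖σ π‖ ^ multiplicity (normIdeal σ hσ) (Ideal.span {x}) := by
  set P := normIdeal σ hσ with hP
  have hπ0 : π ≠ 0 := fun h => hπ2 (h ▸ zero_mem _)
  have hP0 : P ≠ ⊥ := fun h => hπ0 (by simpa [h] using hπ)
  have hPp : Prime P := Ideal.prime_of_isPrime hP0 inferInstance
  -- Elements of norm one outside P play the role of units, which avoids localizing at P.
  have key : ∀ I : Ideal R, ¬ P ∣ I → ∃ t ∈ I, ‖σ t‖ = 1 := by
    intro I hI
    rw [Ideal.dvd_iff_le, SetLike.not_le_iff_exists] at hI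
    obtain ⟨t, ht, htP⟩ := hI
    exact ⟨t, ht, norm_eq_one_of_notMem htP⟩
  have hfin : FiniteMultiplicity P (Ideal.span {x}) :=
    FiniteMultiplicity.of_prime_left hPp (by simpa using hx)
  obtain ⟨I, hI, hIP⟩ := hfin.exists_eq_pow_mul_and_not_dvd
  set v := multiplicity P (Ideal.span {x})
  apply le_antisymm
  -- Write (π) = P J with J prime to P; for u in J of norm one, π^v divides x u^v.
  · obtain ⟨J, hJ⟩ : P ∣ Ideal.span {π} := by
      rwa [Ideal.dvd_span_singleton]
    have hJP : ¬ P ∣ J := by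
      rintro ⟨J', rfl⟩
      apply hπ2
      rw [← Ideal.dvd_span_singleton, hJ, sq, ← mul_assoc]
      exact dvd_mul_right _ _
    obtain ⟨u, hu, hu1⟩ := key J hJP
    have hmem : x * u ^ v ∈ Ideal.span {π ^ v} := by
      rw [← Ideal.span_singleton_pow, hJ, mul_pow]
      refine Ideal.mul_mem_mul ?_ (Ideal.pow_mem_pow hu v)
      rw [← Ideal.dvd_span_singleton]
      exact hI ▸ dvd_mul_right _ _
    obtain ⟨w, hw⟩ := Ideal.mem_span_singleton.mp hmem
    have := congrArg (fun t => ‖σ t‖) hw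
    simp only [map_mul, map_pow, norm_mul, norm_pow, hu1, one_pow, mul_one] at this
    rw [this]
    exact mul_le_of_le_one_right (by positivity) (hσ w)
  · obtain ⟨t, ht, ht1⟩ := key I hIP
    have hmem : π ^ v * t ∈ Ideal.span {x} := by
      rw [hI]
      exact Ideal.mul_mem_mul (Ideal.pow_mem_pow hπ v) ht
    obtain ⟨w, hw⟩ := Ideal.mem_span_singleton.mp hmem
    have := congrArg (fun t => ‖σ t‖) hw
    simp only [map_mul, map_pow, norm_mul, norm_pow, ht1, mul_one] at this
    rw [this]
    exact mul_le_of_le_one_right (by positivity) (hσ w)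

/-- The norm on `R` is determined by its prime ideal and by the norm of `p`. -/
theorem norm_eq_of_normIdeal_eq {p : ℕ} (hΩ : ‖(p : Ω)‖ < 1) (hp0 : (p : Ω) ≠ 0)
    {σ τ : R →+* Ω}
    {hσ : ∀ x, ‖σ x‖ ≤ 1} {hτ : ∀ x, ‖τ x‖ ≤ 1} (h : normIdeal σ hσ = normIdeal τ hτ) (x : R) :
    ‖σ x‖ = ‖τ x‖ := by
  have hpR : (p : R) ≠ 0 := fun h => hp0 (by rw [← map_natCast σ, h, map_zero])
  have hpP : (p : R) ∈ normIdeal σ hσ := by rwa [mem_normIdeal, map_natCast]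
  have hP0 : normIdeal σ hσ ≠ ⊥ := fun h => hpR (by simpa [h] using hpP)
  obtain ⟨π, hπ, hπ2⟩ := (normIdeal σ hσ).exists_mem_pow_notMem_pow_succ hP0
    (Ideal.IsPrime.ne_top inferInstance) 1
  rw [pow_one] at hπ
  rcases eq_or_ne x 0 with rfl | hx
  · simp
  have e1 := norm_eq_pow_multiplicity hπ hπ2 hpR
  have e2 := norm_eq_pow_multiplicity (h ▸ hπ) (h ▸ hπ2) hpR
  rw [map_natCast] at e1 e2
  have hm : multiplicity (normIdeal σ hσ) (Ideal.span {(p : R)}) ≠ 0 := by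
    intro h0
    rw [h0, pow_zero] at e1
    exact hΩ.ne e1
  rw [← h] at e2
  have hππ : ‖σ π‖ = ‖τ π‖ :=
    (pow_left_inj₀ (norm_nonneg _) (norm_nonneg _) hm).mp (e1.symm.trans e2)
  rw [norm_eq_pow_multiplicity hπ hπ2 hx,
    norm_eq_pow_multiplicity (h ▸ hπ) (h ▸ hπ2) hx, ← h, hππ]

/-- With π in P but not in P², both |y| and |p| are powers of |π|. The exponent for p, which is the
ramification index, is therefore l times the exponent for y, and the latter is positive because |y|
≠ 1. -/
theorem le_multiplicity_of_norm_pow_eq {p : ℕ} (hΩ : ‖(p : Ω)‖ < 1) (hp0 : (p : Ω) ≠ 0)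
    {σ : R →+* Ω} (hσi : Function.Injective σ)
    {hσ : ∀ x, ‖σ x‖ ≤ 1} {y : R} {l : ℕ} (hy : ‖σ y‖ ^ l = ‖(p : Ω)‖) :
    l ≤ multiplicity (normIdeal σ hσ) (Ideal.span {(p : R)}) := by
  have hpR : (p : R) ≠ 0 := fun h => hp0 (by rw [← map_natCast σ, h, map_zero])
  have hpP : (p : R) ∈ normIdeal σ hσ := by rwa [mem_normIdeal, map_natCast]
  have hP0 : normIdeal σ hσ ≠ ⊥ := fun h => hpR (by simpa [h] using hpP)
  obtain ⟨π, hπ, hπ2⟩ := (normIdeal σ hσ).exists_mem_pow_notMem_pow_succ hP0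
    (Ideal.IsPrime.ne_top inferInstance) 1
  rw [pow_one] at hπ
  have hπ0 : 0 < ‖σ π‖ := by
    rw [norm_pos_iff, map_ne_zero_iff σ hσi]
    exact fun h => hπ2 (h ▸ zero_mem _)
  rcases Nat.eq_zero_or_pos l with rfl | hl
  · exact Nat.zero_le _
  have hy0 : y ≠ 0 := by
    rintro rfl
    rw [map_zero, norm_zero, zero_pow hl.ne'] at hy
    exact hp0 (norm_eq_zero.mp hy.symm)
  have e1 := norm_eq_pow_multiplicity hπ hπ2 hpR
  rw [map_natCast, ← hy, norm_eq_pow_multiplicity hπ hπ2 hy0, ← pow_mul] at e1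
  have e2 := pow_right_injective₀ hπ0 (mem_normIdeal.mp hπ).ne e1
  rw [← e2]
  refine Nat.le_mul_of_pos_left l (Nat.pos_of_ne_zero fun h0 => ?_)
  have := norm_eq_pow_multiplicity hπ hπ2 hy0
  rw [h0, pow_zero] at this
  rw [this, one_pow] at hy
  exact hΩ.ne hy.symm

end ultrametric

/-! ### Newton polygons through dominant terms on circles -/

section newton

variable {Ω : Type*} [NormedField Ω] [IsUltrametricDist Ω]

theorem norm_sub_eq_left {x y : Ω} (h : ‖y‖ < ‖x‖) : ‖x - y‖ = ‖x‖ := by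
  rw [sub_eq_add_neg, IsUltrametricDist.norm_add_eq_max_of_norm_ne_norm
    (by rw [norm_neg]; exact h.ne'),
    norm_neg, max_eq_left h.le]

/-- If no root of a split polynomial has norm `ρ`, exactly one of its terms dominates on the
circle of radius `ρ`, namely the one whose index is the number of roots of smaller norm. -/
theorem coeff_dominant {ρ : ℝ} (hρ : 0 < ρ) (s : Multiset Ω) (hs : ∀ a ∈ s, ‖a‖ ≠ ρ) (j : ℕ)
    (hj : j ≠ s.countP (‖·‖ < ρ)) :
    ‖(s.map fun a => X - C a).prod.coeff j‖ * ρ ^ j <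
      ‖(s.map fun a => X - C a).prod.coeff (s.countP (‖·‖ < ρ))‖ * ρ ^ s.countP (‖·‖ < ρ) := by
  induction s using Multiset.induction_on generalizing j with
  | empty =>
    simp only [Multiset.countP_zero] at hj ⊢
    simp [coeff_one, hj]
  | cons a s ih =>
    have ih := ih fun b hb => hs b (Multiset.mem_cons_of_mem hb)
    simp only [Multiset.map_cons, Multiset.prod_cons]
    set g := (s.map fun a => X - C a).prod
    set N := s.countP (‖·‖ < ρ)
    set M := ‖g.coeff N‖ * ρ ^ N
    have hM : 0 < M := lt_of_le_of_lt (by positivity) (ih (N + 1) (by simp))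
    have hle : ∀ i, ‖g.coeff i‖ * ρ ^ i ≤ M := fun i => by
      rcases eq_or_ne i N with rfl | hi
      · exact le_rfl
      · exact (ih i hi).le
    have hb : ∀ i, ‖(a * g.coeff i)‖ * ρ ^ i = ‖a‖ * (‖g.coeff i‖ * ρ ^ i) := fun i => by
      rw [norm_mul, mul_assoc]
    have hb' : ∀ i, ‖g.coeff i‖ * ρ ^ (i + 1) = ρ * (‖g.coeff i‖ * ρ ^ i) := fun i => by ring
    have hc0 : ((X - C a) * g).coeff 0 = - (a * g.coeff 0) := by simp [sub_mul]
    have hc : ∀ i, ((X - C a) * g).coeff (i + 1) = g.coeff i - a * g.coeff (i + 1) := fun i => by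
      simp [sub_mul, coeff_X_mul]
    have hlt : ∀ i B, ‖g.coeff i‖ * ρ ^ (i + 1) < B → ‖a * g.coeff (i + 1)‖ * ρ ^ (i + 1) < B →
        ‖((X - C a) * g).coeff (i + 1)‖ * ρ ^ (i + 1) < B := by
      intro i B h1 h2
      rw [hc]
      calc _ ≤ max ‖g.coeff i‖ ‖a * g.coeff (i + 1)‖ * ρ ^ (i + 1) := by
            gcongr
            rw [sub_eq_add_neg, ← norm_neg (a * g.coeff (i + 1))]
            exact IsUltrametricDist.norm_add_le_max _ _
        _ < B := by
            rw [max_mul_of_nonneg _ _ (by positivity)]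
            exact max_lt h1 h2
    rcases lt_or_gt_of_ne (hs a (Multiset.mem_cons_self a s)) with ha | ha
    -- A root inside the circle raises the dominant index by one and multiplies the dominant size by
    -- ρ.
    · rw [Multiset.countP_cons_of_pos (p := (‖·‖ < ρ)) _ ha] at hj ⊢
      have hdom : ‖((X - C a) * g).coeff (N + 1)‖ * ρ ^ (N + 1) = ρ * M := by
        have h1 : ‖a * g.coeff (N + 1)‖ * ρ ^ (N + 1) < ‖g.coeff N‖ * ρ ^ (N + 1) := by
          rw [hb, hb']
          exact (mul_le_mul_of_nonneg_left (hle _) (norm_nonneg a)).trans_lt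
            (mul_lt_mul_of_pos_right ha hM)
        rw [hc, norm_sub_eq_left (lt_of_mul_lt_mul_right h1 (by positivity)), hb']
      rw [hdom]
      have hsmall : ∀ i, ‖a * g.coeff i‖ * ρ ^ i < ρ * M := fun i => by
        rw [hb]
        exact (mul_le_mul_of_nonneg_left (hle _) (norm_nonneg a)).trans_lt
            (mul_lt_mul_of_pos_right ha hM)
      rcases j with _ | j
      · rw [hc0, norm_neg]
        exact hsmall 0
      · refine hlt j _ ?_ (hsmall _)
        rw [hb']
        exact mul_lt_mul_of_pos_left (ih j fun h => hj (by rw [h])) hρ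
    -- A root outside keeps the dominant index and multiplies the dominant size by its own norm.
    · have ha0 : 0 < ‖a‖ := hρ.trans ha
      rw [Multiset.countP_cons_of_neg (p := (‖·‖ < ρ)) _ (not_lt.mpr ha.le)] at hj ⊢
      have hsmall : ∀ i, ‖g.coeff i‖ * ρ ^ (i + 1) < ‖a‖ * M := fun i => by
        rw [hb']
        exact (mul_le_mul_of_nonneg_left (hle _) hρ.le).trans_lt
            (mul_lt_mul_of_pos_right ha hM)
      have hdom : ‖((X - C a) * g).coeff N‖ * ρ ^ N = ‖a‖ * M := by
        rcases hN : N with _ | i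
        · rw [hc0, norm_neg, hb, ← hN]
        · have h1 : ‖g.coeff i‖ * ρ ^ (i + 1) < ‖a * g.coeff (i + 1)‖ * ρ ^ (i + 1) := by
            have hMi : M = ‖g.coeff (i + 1)‖ * ρ ^ (i + 1) := by rw [← hN]
            rw [hb, ← hMi]
            exact hsmall i
          rw [hc, norm_sub_rev, norm_sub_eq_left (lt_of_mul_lt_mul_right h1 (by positivity)), hb,
            ← hN]
      rw [hdom]
      have hj' : ‖a * g.coeff j‖ * ρ ^ j < ‖a‖ * M := by
        rw [hb]
        exact mul_lt_mul_of_pos_left (ih j hj) ha0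
      rcases j with _ | j
      · rwa [hc0, norm_neg]
      · exact hlt j _ (hsmall j) hj'

variable [IsAlgClosed Ω]

/-- Two terms tied for the maximum contradict the strict dominance in `coeff_dominant`, so some root
lies on the circle. -/
theorem exists_root_norm_eq {g : Polynomial Ω} (hg : g.Monic) {ρ : ℝ} (hρ : 0 < ρ)
    {i j : ℕ} (hij : i ≠ j)
    {M : ℝ} (hi : ‖g.coeff i‖ * ρ ^ i = M) (hj : ‖g.coeff j‖ * ρ ^ j = M)
    (hM : ∀ k, ‖g.coeff k‖ * ρ ^ k ≤ M) : ∃ z, g.IsRoot z ∧ ‖z‖ = ρ := by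
  by_contra! h
  have hprod := (IsAlgClosed.splits g).eq_prod_roots_of_monic hg
  have hdom := coeff_dominant hρ g.roots fun a ha => h a (isRoot_of_mem_roots ha)
  rw [← hprod] at hdom
  rcases eq_or_ne i (g.roots.countP (‖·‖ < ρ)) with h1 | h1
  · have := hdom j (h1 ▸ hij.symm)
    exact (this.trans_le (hM _)).ne hj
  · exact ((hdom i h1).trans_le (hM _)).ne hi

theorem exists_root_norm_le {g : Polynomial Ω} (hg : g.Monic) {ρ : ℝ} (hρ : 0 < ρ)
    {j : ℕ} (hj : j ≠ 0)
    (h : ‖g.coeff 0‖ ≤ ‖g.coeff j‖ * ρ ^ j) : ∃ z, g.IsRoot z ∧ ‖z‖ ≤ ρ := by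
  by_contra! hcon
  have hprod := (IsAlgClosed.splits g).eq_prod_roots_of_monic hg
  have hdom := coeff_dominant hρ g.roots fun a ha => (hcon a (isRoot_of_mem_roots ha)).ne'
  have hN : g.roots.countP (‖·‖ < ρ) = 0 :=
    Multiset.countP_eq_zero.mpr fun a ha => not_lt.mpr (hcon a (isRoot_of_mem_roots ha)).le
  rw [← hprod, hN] at hdom
  have := hdom j hj
  rw [pow_zero, mul_one] at this
  exact absurd h (not_le.mpr this)

end newton

/-! ### Valuations of binomial coefficients -/

section coefficients

theorem not_dvd_choose_mul_pow_sub_one {p : ℕ} [hp : Fact p.Prime] {M : ℕ} (hM : 0 < M) (i : ℕ) :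
    ¬ p ∣ (M * p ^ i - 1).choose (p ^ i - 1) := by
  have hp1 := hp.out.one_lt
  induction i with
  | zero => simpa using hp1.ne'
  | succ i ih =>
    -- The last base-p digit of M' p^(i+1) - 1 is p - 1 and the other digits form M' p^i - 1, so
    -- Lucas' theorem strips one digit.
    have key : ∀ M', 0 < M' → (M' * p ^ (i + 1) - 1) % p = p - 1 ∧
        (M' * p ^ (i + 1) - 1) / p = M' * p ^ i - 1 := by
      intro M' hM'
      have h1 : 0 < M' * p ^ i := by positivity
      obtain ⟨q, hq⟩ := Nat.exists_eq_succ_of_ne_zero h1.ne'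
      have : M' * p ^ (i + 1) - 1 = (p - 1) + p * q := by
        rw [pow_succ, ← mul_assoc, hq, Nat.succ_eq_add_one, add_mul, one_mul, mul_comm q]
        omega
      rw [this, Nat.add_mul_mod_self_left, Nat.add_mul_div_left _ _ (by omega),
        Nat.mod_eq_of_lt (by omega), Nat.div_eq_of_lt (by omega), hq]
      simp
    have hk := key 1 one_pos
    rw [one_mul, one_mul] at hk
    rw [(Choose.choose_modEq_choose_mod_mul_choose_div_nat (p := p)).dvd_iff dvd_rfl,
      hk.1, hk.2, (key M hM).1, (key M hM).2, Nat.choose_self, one_mul]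
    exact ih

variable {Ω : Type*} [NormedField Ω] [IsUltrametricDist Ω] {p : ℕ} [hp : Fact p.Prime]

theorem norm_natCast_eq_one (hΩ : ‖(p : Ω)‖ < 1) {j : ℕ} (hj : ¬ p ∣ j) : ‖(j : Ω)‖ = 1 := by
  have := norm_intCast_eq_one hp.out hΩ (z := j) (by exact_mod_cast hj)
  simpa using this

theorem norm_natCast_eq_pow (hΩ : ‖(p : Ω)‖ < 1) {j : ℕ} (hj : j ≠ 0) :
    ‖(j : Ω)‖ = ‖(p : Ω)‖ ^ padicValNat p j := by
  obtain ⟨e, j', hj', rfl⟩ := Nat.exists_eq_pow_mul_and_not_dvd hj p hp.out.ne_one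
  rw [padicValNat.mul (by simp [hp.out.ne_zero]) (by rintro rfl; simp at hj'),
    padicValNat.prime_pow, padicValNat.eq_zero_of_not_dvd hj', add_zero]
  push_cast
  rw [norm_mul, norm_pow, norm_natCast_eq_one hΩ hj', mul_one]

theorem natCast_mul_choose {R : Type*} [CommRing R] {n j : ℕ} (hn : n ≠ 0) (hj : j ≠ 0) :
    (j : R) * (n.choose j : ℕ) = n * ((n - 1).choose (j - 1) : ℕ) := by
  obtain ⟨n, rfl⟩ := Nat.exists_eq_succ_of_ne_zero hn
  obtain ⟨j, rfl⟩ := Nat.exists_eq_succ_of_ne_zero hj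
  have := Nat.add_one_mul_choose_eq n j
  simp only [Nat.succ_eq_add_one, Nat.add_sub_cancel]
  exact_mod_cast congrArg (Nat.cast (R := R)) ((mul_comm _ _).trans this.symm)

variable {s r n : ℕ}

theorem norm_choose_le (hΩ : ‖(p : Ω)‖ < 1) (hp0 : (p : Ω) ≠ 0) (hs : ¬ p ∣ s)
    (hn : n = s * p ^ r) {j : ℕ} (hj : j ≠ 0) :
    ‖((n.choose j : ℕ) : Ω)‖ ≤ ‖(p : Ω)‖ ^ (r - padicValNat p j) := by
  have hc : 0 < ‖(p : Ω)‖ := norm_pos_iff.mpr hp0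
  rcases le_or_gt r (padicValNat p j) with h | h
  · rw [Nat.sub_eq_zero_of_le h, pow_zero]
    exact IsUltrametricDist.norm_natCast_le_one Ω _
  · have hs0 : s ≠ 0 := by rintro rfl; simp at hs
    have hn0 : n ≠ 0 := by rw [hn]; exact mul_ne_zero hs0 (pow_ne_zero _ hp.out.ne_zero)
    have e := congrArg norm (natCast_mul_choose (R := Ω) hn0 hj)
    have hnn : ‖(n : Ω)‖ = ‖(p : Ω)‖ ^ r := by
      rw [hn]; push_cast; rw [norm_mul, norm_pow, norm_natCast_eq_one hΩ hs, one_mul]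
    rw [norm_mul, norm_mul, norm_natCast_eq_pow hΩ hj, hnn] at e
    refine le_of_mul_le_mul_left ?_ (pow_pos hc (padicValNat p j))
    rw [e, ← pow_add, Nat.add_sub_cancel' h.le]
    exact mul_le_of_le_one_right (by positivity) (IsUltrametricDist.norm_natCast_le_one Ω _)

/-- In j · n.choose j = n · (n - 1).choose (j - 1) the last factor is prime to p when j = p^i. These
are the vertices of the polygon; `norm_choose_le` bounds the other points. -/
theorem norm_choose_prime_pow (hΩ : ‖(p : Ω)‖ < 1) (hp0 : (p : Ω) ≠ 0) (hs : ¬ p ∣ s)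
    (hn : n = s * p ^ r) {i : ℕ} (hi : i ≤ r) :
    ‖((n.choose (p ^ i) : ℕ) : Ω)‖ = ‖(p : Ω)‖ ^ (r - i) := by
  have hc : 0 < ‖(p : Ω)‖ := norm_pos_iff.mpr hp0
  have hs0 : s ≠ 0 := by rintro rfl; simp at hs
  have hn0 : n ≠ 0 := by rw [hn]; exact mul_ne_zero hs0 (pow_ne_zero _ hp.out.ne_zero)
  have e := congrArg norm (natCast_mul_choose (R := Ω) (j := p ^ i) hn0
    (pow_ne_zero _ hp.out.ne_zero))
  have hnn : ‖(n : Ω)‖ = ‖(p : Ω)‖ ^ r := by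
    rw [hn]; push_cast; rw [norm_mul, norm_pow, norm_natCast_eq_one hΩ hs, one_mul]
  have hd : ¬ p ∣ (n - 1).choose (p ^ i - 1) := by
    have := not_dvd_choose_mul_pow_sub_one (p := p) (M := s * p ^ (r - i))
      (Nat.mul_pos (Nat.pos_of_ne_zero hs0) (pow_pos hp.out.pos _)) i
    rwa [mul_assoc, ← pow_add, Nat.sub_add_cancel hi, ← hn] at this
  rw [norm_mul, norm_mul, norm_natCast_eq_one hΩ hd, hnn, mul_one] at e
  push_cast at e
  rw [norm_pow] at e
  apply mul_left_cancel₀ (pow_pos hc i).ne'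
  rw [e, ← pow_add, Nat.add_sub_cancel' hi]

end coefficients

/-! ### A polygon all of whose sides have height one -/

section polygon

/-- The lengths of the sides of the Newton polygon with vertices `(0, k + 1)`, `(p ^ a, k)`,
`(p ^ (a + 1), k - 1)`, …, `(p ^ (a + k), 0)`. -/
def sideLength (p a : ℕ) : ℕ → ℕ
  | 0 => p ^ a
  | i + 1 => p ^ (a + i) * (p - 1)

theorem sum_sideLength {p : ℕ} (hp : 0 < p) (a k : ℕ) :
    ∑ i ∈ Finset.range (k + 1), sideLength p a i = p ^ (a + k) := by
  induction k with
  | zero => simp [sideLength]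
  | succ k ih =>
    rw [Finset.sum_range_succ, ih, sideLength, ← add_assoc, pow_succ]
    obtain ⟨q, rfl⟩ := Nat.exists_eq_succ_of_ne_zero hp.ne'
    simp only [Nat.succ_eq_add_one, Nat.add_sub_cancel]
    ring

theorem sideLength_pos {p : ℕ} (hp : 1 < p) (a i : ℕ) : 0 < sideLength p a i := by
  have : 0 < p - 1 := by omega
  cases i <;> simp only [sideLength] <;> positivity

/-- Distinct lengths separate the primes of different sides. This needs p > 2: for p = 2 the first
two sides have equal length. -/
theorem sideLength_strictMono {p : ℕ} (hp : 2 < p) (a : ℕ) : StrictMono (sideLength p a) := by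
  refine strictMono_nat_of_lt_succ fun i => ?_
  cases i with
  | zero =>
    simp only [sideLength, add_zero]
    exact lt_mul_of_one_lt_right (by positivity) (by omega)
  | succ i =>
    simp only [sideLength]
    exact mul_lt_mul_of_pos_right (Nat.pow_lt_pow_right (by omega) (by omega)) (by omega)

/-- `x` is the absolute value of a root belonging to a side of length `l` and height one, where a
side of length one is allowed to be steeper. -/
def HasSlope (c x : ℝ) (l : ℕ) : Prop := x ^ l = c ∨ (l = 1 ∧ x ≤ c)

theorem HasSlope.unique {c x : ℝ} (hc0 : 0 < c) (hc1 : c < 1) (hx : 0 ≤ x) {l l' : ℕ} (hl : l ≠ 0)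
    (hl' : l' ≠ 0) (h : HasSlope c x l) (h' : HasSlope c x l') : l = l' := by
  have key : ∀ {l l' : ℕ}, l ≠ 0 → x ^ l = c → HasSlope c x l' → l' ≠ 0 → l = l' := by
    intro l l' hl h h' hl'
    have hx0 : 0 < x := lt_of_le_of_ne hx (by rintro rfl; rw [zero_pow hl] at h; exact hc0.ne h)
    have hx1 : x < 1 := by
      by_contra! h1
      exact absurd (one_le_pow₀ h1 (n := l)) (by rw [h]; exact not_le.mpr hc1)
    rcases h' with h' | ⟨rfl, h'⟩
    · exact pow_right_injective₀ hx0 hx1.ne (h.trans h'.symm)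
    · rw [← h] at h'
      by_contra hne
      have : x ^ l < x ^ 1 := pow_lt_pow_right_of_lt_one₀ hx0 hx1 (by omega)
      rw [pow_one] at this
      exact absurd h' (not_le.mpr this)
  rcases h with h | ⟨rfl, h⟩
  · exact key hl h h' hl'
  · rcases h' with h' | ⟨rfl, h'⟩
    · exact (key hl' h' (Or.inr ⟨rfl, h⟩) one_ne_zero).symm
    · rfl

theorem HasSlope.lt_one {c x : ℝ} (hc1 : c < 1) {l : ℕ} (h : HasSlope c x l) : x < 1 := by
  rcases h with h | ⟨rfl, h⟩
  · by_contra! h1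
    exact absurd (one_le_pow₀ h1 (n := l)) (by rw [h]; exact not_le.mpr hc1)
  · exact h.trans_lt hc1

variable {Ω : Type*} [NormedField Ω] [IsUltrametricDist Ω] [IsAlgClosed Ω]
  {p : ℕ} [hp : Fact p.Prime]

/-- On the circle ρ^l = c the terms at the two ends of the side of length l tie, and j ≥ p^(v_p(j))
keeps all other terms below them. The cap k + 1 in the bound leaves room for the contribution of the
middle term of the trinomial. For a = 0 the constant term may be too small for a tie, and only a
root of norm at most c is obtained. -/
theorem exists_root_hasSlope {c : ℝ} (hc0 : 0 < c) (hc1 : c < 1) (hp2 : 2 < p) {g : Polynomial Ω}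
    (hg : g.Monic) {a k : ℕ} (h0 : ‖g.coeff 0‖ ≤ c ^ (k + 1))
    (h0' : ‖g.coeff 0‖ = c ^ (k + 1) ∨ a = 0)
    (hle : ∀ j, j ≠ 0 → ‖g.coeff j‖ ≤ c ^ min (a + k - padicValNat p j) (k + 1))
    (heq : ∀ i ≤ k, ‖g.coeff (p ^ (a + i))‖ = c ^ (k - i)) {i : ℕ} (hi : i ≤ k) :
    ∃ z, g.IsRoot z ∧ HasSlope c ‖z‖ (sideLength p a i) := by
  have hp1 : 1 < p := hp.out.one_lt
  set l := sideLength p a i with hl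
  have hl0 : l ≠ 0 := (sideLength_pos hp1 a i).ne'
  obtain ⟨ρ, hρ0, hρ1, hρ⟩ : ∃ ρ : ℝ, 0 < ρ ∧ ρ < 1 ∧ ρ ^ l = c := by
    refine ⟨c ^ ((l : ℝ)⁻¹), by positivity, Real.rpow_lt_one hc0.le hc1 (by positivity), ?_⟩
    exact Real.rpow_inv_natCast_pow hc0.le hl0
  -- All comparisons become inequalities between exponents of ρ, a factor c counting as l.
  have hbound : ∀ {E h j : ℕ}, ‖g.coeff j‖ ≤ c ^ h → E ≤ l * h + j →
      ‖g.coeff j‖ * ρ ^ j ≤ ρ ^ E := by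
    intro E h j h1 h2
    calc _ ≤ c ^ h * ρ ^ j := by gcongr
      _ = ρ ^ (l * h + j) := by rw [← hρ, ← pow_mul, pow_add]
      _ ≤ _ := pow_le_pow_of_le_one hρ0.le hρ1.le h2
  have hpv : ∀ j, j ≠ 0 → p ^ padicValNat p j ≤ j := fun j hj =>
    Nat.le_of_dvd (Nat.pos_of_ne_zero hj) pow_padicValNat_dvd
  have hpow : ∀ j, c ^ j = ρ ^ (l * j) := fun j => by rw [← hρ, ← pow_mul]
  cases i with
  | zero =>
    simp only [sideLength] at hl
    rcases h0' with h0' | rfl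
    · obtain ⟨z, hz, hz'⟩ := exists_root_norm_eq hg hρ0 (i := 0) (j := p ^ a)
        (by simpa using (pow_pos hp.out.pos a).ne) (M := ρ ^ (l * (k + 1)))
        (by rw [h0', pow_zero, mul_one, hpow])
        (by
          have := heq 0 (Nat.zero_le k)
          rw [add_zero, Nat.sub_zero] at this
          rw [this, hpow, ← pow_add, ← hl]
          ring_nf)
        (by
          intro j
          rcases eq_or_ne j 0 with rfl | hj
          · exact hbound h0 (by omega)
          · refine hbound (hle j hj) ?_
            rcases Nat.lt_or_ge (padicValNat p j) a with ht | ht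
            · rw [min_eq_right (by omega)]
              omega
            · obtain ⟨d, hd⟩ := Nat.exists_eq_add_of_le ht
              have h1 := hpv j hj
              rw [hd, pow_add, ← hl] at h1
              -- The height drops by d while j is at least l p^d, and l (d + 1) already compensates.
              have h2 : d + 1 ≤ p ^ d := Nat.lt_pow_self hp1
              have h3 : l * (d + 1) ≤ l * p ^ d := Nat.mul_le_mul_left _ h2
              rw [hd, min_eq_left (by omega)]
              calc l * (k + 1) ≤ l * ((a + k - (a + d)) + (d + 1)) :=
                    Nat.mul_le_mul_left _ (by omega)
                _ ≤ _ := by rw [mul_add]; omega)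
      exact ⟨z, hz, Or.inl (by rw [hz', hρ])⟩
    · have hl1 : l = 1 := by rw [hl, pow_zero]
      rw [hl1, pow_one] at hρ
      obtain ⟨z, hz, hz'⟩ := exists_root_norm_le hg hρ0 (j := 1) one_ne_zero (by
        have := heq 0 (Nat.zero_le k)
        rw [add_zero, pow_zero, Nat.sub_zero] at this
        rw [this, hρ, pow_one, ← pow_succ]
        exact h0)
      exact ⟨z, hz, Or.inr ⟨hl1, by rwa [← hρ]⟩⟩
  | succ i =>
    simp only [sideLength] at hl
    have hpl : p ^ (a + i) ≤ l := by
      rw [hl]; exact Nat.le_mul_of_pos_right _ (by omega)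
    have hpl' : p ^ (a + (i + 1)) = l + p ^ (a + i) := by
      rw [hl, ← add_assoc, pow_succ]
      obtain ⟨q, hq⟩ := Nat.exists_eq_succ_of_ne_zero hp.out.ne_zero
      rw [hq]
      simp only [Nat.succ_eq_add_one, Nat.add_sub_cancel]
      ring
    obtain ⟨z, hz, hz'⟩ := exists_root_norm_eq hg hρ0 (i := p ^ (a + i)) (j := p ^ (a + (i + 1)))
        (by omega) (M := ρ ^ (l * (k - i) + p ^ (a + i)))
        (by rw [heq i (by omega), hpow, ← pow_add])
        (by
          rw [heq (i + 1) hi, hpow, ← pow_add, hpl']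
          congr 1
          obtain ⟨d, rfl⟩ := Nat.exists_eq_add_of_le hi
          rw [show i + 1 + d - (i + 1) = d by omega, show i + 1 + d - i = d + 1 by omega]
          ring)
        (by
          intro j
          have hbig : l * (k - i) + l ≤ l * (k + 1) := by
            rw [← Nat.mul_succ]; exact Nat.mul_le_mul_left _ (by omega)
          rcases eq_or_ne j 0 with rfl | hj
          · exact hbound h0 (by omega)
          · refine hbound (hle j hj) ?_
            rcases Nat.lt_or_ge (padicValNat p j) (a + i) with ht | ht
            · have : l * (k - i) + l ≤ l * min (a + k - padicValNat p j) (k + 1) := by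
                rw [← Nat.mul_succ]; exact Nat.mul_le_mul_left _ (by omega)
              omega
            · obtain ⟨d, hd⟩ := Nat.exists_eq_add_of_le ht
              have h1 := hpv j hj
              rw [hd, pow_add] at h1
              -- Bernoulli's inequality expresses the convexity of the polygon to the right of
              -- p^(a+i).
              have h2 : 1 + d * (p - 1) ≤ p ^ d := by
                have := one_add_mul_le_pow (R := ℤ) (a := (p : ℤ) - 1) (by omega) d
                zify [hp1.le]
                simpa using this
              have h3 : p ^ (a + i) + l * d ≤ p ^ (a + i) * p ^ d := by
                calc _ = p ^ (a + i) * (1 + d * (p - 1)) := by rw [hl]; ring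
                  _ ≤ _ := Nat.mul_le_mul_left _ h2
              rw [hd, min_eq_left (by omega)]
              calc l * (k - i) + p ^ (a + i) ≤ l * ((a + k - (a + i + d)) + d) + p ^ (a + i) :=
                    Nat.add_le_add_right (Nat.mul_le_mul_left _ (by omega)) _
                _ ≤ _ := by rw [mul_add]; omega)
    exact ⟨z, hz, Or.inl (by rw [hz', hρ])⟩

end polygon

/-! ### Roots of the trinomial near a root of x^s + B -/

section trinomial

variable {Ω : Type*} [NormedField Ω] [IsUltrametricDist Ω] {p : ℕ} [hp : Fact p.Prime]

theorem norm_intCast_le_pow {p : ℕ} {z : ℤ} {k : ℕ} (h : (p : ℤ) ^ k ∣ z) :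
    ‖(z : Ω)‖ ≤ ‖(p : Ω)‖ ^ k := by
  obtain ⟨w, rfl⟩ := h
  push_cast
  rw [norm_mul, norm_pow]
  exact mul_le_of_le_one_right (by positivity) (IsUltrametricDist.norm_intCast_le_one Ω w)

theorem norm_intCast_eq_pow (hΩ : ‖(p : Ω)‖ < 1) {z : ℤ} {k : ℕ}
    (h : emultiplicity (p : ℤ) z = k) : ‖(z : Ω)‖ = ‖(p : Ω)‖ ^ k := by
  obtain ⟨h1, h2⟩ := emultiplicity_eq_coe.mp h
  obtain ⟨w, rfl⟩ := h1
  have hw : ¬ (p : ℤ) ∣ w := by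
    rintro ⟨v, rfl⟩
    exact h2 ⟨v, by ring⟩
  push_cast
  rw [norm_mul, norm_pow, norm_intCast_eq_one hp.out hΩ hw, mul_one]

/-- Here p^r - 1 = u (p - 1) with u = 1 + p + … + p^(r-1) prime to p, and raising b^(p-1) ≡ 1 to a
power prime to p keeps the valuation of its difference from 1. Thus ν measures the constant term of
F(x + ζ). -/
theorem emultiplicity_pow_prime_pow_sub_self {b : ℤ} (hb : ¬ (p : ℤ) ∣ b) {r : ℕ} (hr : r ≠ 0) :
    emultiplicity (p : ℤ) (b - b ^ p ^ r) = emultiplicity (p : ℤ) (b ^ (p - 1) - 1) := by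
  have hpZ : Prime (p : ℤ) := Nat.prime_iff_prime_int.mp hp.out
  have hp1 := hp.out.one_lt
  set u := ∑ i ∈ Finset.range r, p ^ i with hu
  have hu' : u * (p - 1) + 1 = p ^ r := by
    have := geom_sum_mul_add (p - 1) r
    rwa [Nat.sub_add_cancel hp1.le] at this
  have hpu : ¬ p ∣ u := by
    obtain ⟨r', rfl⟩ := Nat.exists_eq_succ_of_ne_zero hr
    rw [hu, Finset.sum_range_succ', pow_zero, ← Nat.dvd_add_iff_right ?_]
    · exact fun h => hp1.ne' (Nat.dvd_one.mp h)
    · exact Finset.dvd_sum fun i _ => dvd_pow_self p (Nat.succ_ne_zero i)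
  have hfermat : (p : ℤ) ∣ b ^ (p - 1) - 1 := by
    have := Int.ModEq.pow_card_sub_one_eq_one hp.out
      ((Prime.coprime_iff_not_dvd hpZ).mpr hb).symm
    exact (Int.modEq_iff_dvd.mp this.symm)
  have hb1 : ¬ (p : ℤ) ∣ b ^ (p - 1) := fun h => hb (hpZ.dvd_of_dvd_pow h)
  have h1 := emultiplicity_pow_sub_pow_of_prime hpZ (y := 1) hfermat hb1 (n := u)
    (by exact_mod_cast hpu)
  rw [one_pow, ← pow_mul, mul_comm] at h1
  rw [← hu', pow_succ, show b - b ^ (u * (p - 1)) * b = -(b * (b ^ (u * (p - 1)) - 1)) by ring,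
    emultiplicity_neg, emultiplicity_mul hpZ, emultiplicity_eq_zero.mpr hb, zero_add, h1]

variable {A B : ℤ} {n m s a k : ℕ} {ζ : Ω}

theorem coeff_trinomial_comp {R : Type*} [CommRing R] (A B ζ : R) (n m j : ℕ) :
    ((X ^ n + C A * X ^ m + C B).comp (X + C ζ)).coeff j =
      ζ ^ (n - j) * (n.choose j : ℕ) + A * (ζ ^ (m - j) * (m.choose j : ℕ)) +
        if j = 0 then B else 0 := by
  simp only [add_comp, mul_comp, pow_comp, X_comp, C_comp, coeff_add, coeff_C_mul,
    coeff_X_add_C_pow, coeff_C]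

theorem norm_add_of_lt {x y : Ω} (h : ‖y‖ < ‖x‖) : ‖x + y‖ = ‖x‖ := by
  rw [IsUltrametricDist.norm_add_eq_max_of_norm_ne_norm h.ne', max_eq_left h.le]

/-- The roots of `x ^ n + A x ^ m + B` near a root `ζ` of `x ^ s + B`, where `n = s p ^ (a + k)`. -/
theorem exists_root_trinomial [IsAlgClosed Ω] (hΩ : ‖(p : Ω)‖ < 1) (hp0 : (p : Ω) ≠ 0)
    (hp2 : 2 < p) (hmn : m < n) (hs : ¬ p ∣ s) (hn : n = s * p ^ (a + k))
    (hB : ¬ (p : ℤ) ∣ B) (hζ : ζ ^ s = -(B : Ω))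
    (hA : ‖(A : Ω)‖ ≤ ‖(p : Ω)‖ ^ (k + 1))
    (hB' : ‖((B - B ^ p ^ (a + k) : ℤ) : Ω)‖ ≤ ‖(p : Ω)‖ ^ (k + 1))
    (hAB : a = 0 ∨ (‖(A : Ω)‖ = ‖(p : Ω)‖ ^ (k + 1) ∧
        ‖((B - B ^ p ^ (a + k) : ℤ) : Ω)‖ < ‖(p : Ω)‖ ^ (k + 1)) ∨
      (‖(A : Ω)‖ < ‖(p : Ω)‖ ^ (k + 1) ∧
        ‖((B - B ^ p ^ (a + k) : ℤ) : Ω)‖ = ‖(p : Ω)‖ ^ (k + 1))) {i : ℕ} (hi : i ≤ k) :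
    ∃ w : Ω, w ^ n + A * w ^ m + B = 0 ∧ HasSlope ‖(p : Ω)‖ ‖w - ζ‖ (sideLength p a i) := by
  have hc0 : 0 < ‖(p : Ω)‖ := norm_pos_iff.mpr hp0
  have hs0 : s ≠ 0 := by rintro rfl; simp at hs
  have hζ1 : ‖ζ‖ = 1 := by
    rw [← pow_eq_one_iff_of_nonneg (norm_nonneg _) hs0, ← norm_pow, hζ, norm_neg,
      norm_intCast_eq_one hp.out hΩ hB]
  set F : Polynomial Ω := X ^ n + C (A : Ω) * X ^ m + C (B : Ω) with hF
  have hFm : F.Monic := by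
    rw [hF, add_assoc]
    refine monic_X_pow_add ?_
    refine (degree_add_le _ _).trans_lt (max_lt ?_ ?_)
    · exact (degree_C_mul_X_pow_le m _).trans_lt (by exact_mod_cast hmn)
    · exact degree_C_le.trans_lt (by exact_mod_cast Nat.zero_lt_of_lt hmn)
  set g := F.comp (X + C ζ) with hg
  have hgm : g.Monic := hFm.comp_X_add_C ζ
  have hg0 : g.coeff 0 = ((B - B ^ p ^ (a + k) : ℤ) : Ω) + A * ζ ^ m := by
    rw [hg, hF, coeff_trinomial_comp]
    -- The sign survives because p is odd.
    have : ζ ^ n = - (B : Ω) ^ p ^ (a + k) := by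
      rw [hn, pow_mul, hζ, Odd.neg_pow]
      exact (hp.out.odd_of_ne_two hp2.ne').pow
    simp only [Nat.sub_zero, Nat.choose_zero_right, if_true, this]
    push_cast
    ring
  have hAz : ‖(A : Ω) * ζ ^ m‖ = ‖(A : Ω)‖ := by rw [norm_mul, norm_pow, hζ1, one_pow, mul_one]
  have hgj : ∀ j, j ≠ 0 → g.coeff j =
      ζ ^ (n - j) * (n.choose j : ℕ) + A * (ζ ^ (m - j) * (m.choose j : ℕ)) := by
    intro j hj
    rw [hg, hF, coeff_trinomial_comp, if_neg hj, add_zero]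
  have hfirst : ∀ j, ‖ζ ^ (n - j) * ((n.choose j : ℕ) : Ω)‖ = ‖((n.choose j : ℕ) : Ω)‖ := by
    intro j
    rw [norm_mul, norm_pow, hζ1, one_pow, one_mul]
  have hsecond : ∀ j, ‖(A : Ω) * (ζ ^ (m - j) * (m.choose j : ℕ))‖ ≤ ‖(p : Ω)‖ ^ (k + 1) := by
    intro j
    rw [norm_mul, norm_mul, norm_pow, hζ1, one_pow, one_mul]
    exact (mul_le_of_le_one_right (norm_nonneg _)
      (IsUltrametricDist.norm_natCast_le_one Ω _)).trans hA
  obtain ⟨z, hz, hz'⟩ := exists_root_hasSlope hc0 hΩ hp2 hgm (a := a) (k := k)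
    (by
      rw [hg0]
      exact (IsUltrametricDist.norm_add_le_max _ _).trans (max_le hB' (hAz.trans_le hA)))
    (by
      -- Unequal valuations of the two summands exclude cancellation in the constant term.
      rcases hAB with h | ⟨h1, h2⟩ | ⟨h1, h2⟩
      · exact Or.inr h
      · left
        rw [hg0, add_comm, norm_add_of_lt (by rwa [hAz, h1]), hAz, h1]
      · left
        rw [hg0, norm_add_of_lt (by rwa [hAz, h2]), h2])
    (by
      intro j hj
      rw [hgj j hj]
      refine (IsUltrametricDist.norm_add_le_max _ _).trans (max_le ?_ ?_)
      · rw [hfirst]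
        exact (norm_choose_le hΩ hp0 hs hn hj).trans
          (pow_le_pow_of_le_one hc0.le hΩ.le (min_le_left _ _))
      · exact (hsecond j).trans (pow_le_pow_of_le_one hc0.le hΩ.le (min_le_right _ _)))
    (by
      intro i hi
      have h1 := norm_choose_prime_pow hΩ hp0 hs hn (i := a + i) (by omega)
      rw [Nat.add_sub_add_left] at h1
      rw [hgj _ (pow_ne_zero _ hp.out.ne_zero), norm_add_of_lt, hfirst, h1]
      rw [hfirst, h1]
      exact (hsecond _).trans_lt (pow_lt_pow_right_of_lt_one₀ hc0 hΩ (by omega)))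
    hi
  refine ⟨z + ζ, ?_, by rwa [add_sub_cancel_right]⟩
  rw [hg, IsRoot, eval_comp] at hz
  simpa [hF] using hz

theorem norm_aeval_sub_le {x y : Ω} (hx : IsIntegral ℤ x) (hy : IsIntegral ℤ y) (Q : ℤ[X]) :
    ‖aeval x Q - aeval y Q‖ ≤ ‖x - y‖ := by
  let x' : integralClosure ℤ Ω := ⟨x, hx⟩
  let y' : integralClosure ℤ Ω := ⟨y, hy⟩
  obtain ⟨w, hw⟩ := sub_dvd_eval_sub x' y' (Q.map (algebraMap ℤ (integralClosure ℤ Ω)))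
  rw [eval_map_algebraMap, eval_map_algebraMap] at hw
  have := congrArg (algebraMap (integralClosure ℤ Ω) Ω) hw
  rw [map_sub, map_mul, map_sub, ← aeval_algebraMap_apply, ← aeval_algebraMap_apply] at this
  change aeval x Q - aeval y Q = (x - y) * (w : Ω) at this
  rw [this, norm_mul]
  exact mul_le_of_le_one_right (norm_nonneg _) (norm_le_one_of_isIntegral w.2)

/-- Expanding around ζ, the linear coefficient s ζ^(s-1) has norm one, so the linear term dominates.
-/
theorem norm_pow_sub_pow_eq (hΩ : ‖(p : Ω)‖ < 1) (hs : ¬ p ∣ s) {w : Ω} (hw : IsIntegral ℤ w)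
    (hζ : IsIntegral ℤ ζ) (hζ1 : ‖ζ‖ = 1) (hwζ : ‖w - ζ‖ < 1) : ‖w ^ s - ζ ^ s‖ = ‖w - ζ‖ := by
  rcases eq_or_ne w ζ with rfl | hne
  · simp
  have hpos : 0 < ‖w - ζ‖ := norm_pos_iff.mpr (sub_ne_zero.mpr hne)
  let x' : integralClosure ℤ Ω := ⟨ζ, hζ⟩
  let y' : integralClosure ℤ Ω := ⟨w - ζ, hw.sub hζ⟩
  obtain ⟨u, hu⟩ := Polynomial.powAddExpansion x' y' s
  have := congrArg (algebraMap (integralClosure ℤ Ω) Ω) hu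
  simp only [map_add, map_mul, map_pow, map_natCast] at this
  change (ζ + (w - ζ)) ^ s = ζ ^ s + s * ζ ^ (s - 1) * (w - ζ) + (u : Ω) * (w - ζ) ^ 2 at this
  have h1 : w ^ s - ζ ^ s = s * ζ ^ (s - 1) * (w - ζ) + (u : Ω) * (w - ζ) ^ 2 := by
    rw [add_sub_cancel] at this
    rw [this]; ring
  have h2 : ‖(s : Ω) * ζ ^ (s - 1) * (w - ζ)‖ = ‖w - ζ‖ := by
    rw [norm_mul, norm_mul, norm_pow, hζ1, one_pow, mul_one, norm_natCast_eq_one hΩ hs, one_mul]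
  rw [h1, norm_add_of_lt, h2]
  rw [h2, norm_mul, norm_pow, sq]
  calc _ ≤ 1 * (‖w - ζ‖ * ‖w - ζ‖) := by
        gcongr
        exact norm_le_one_of_isIntegral u.2
    _ < ‖w - ζ‖ := by
        rw [one_mul]
        exact mul_lt_of_lt_one_left hpos hwζ

theorem exists_C_mul_of_map_eq_zero {f : ℤ[X]} (h : f.map (Int.castRingHom (ZMod p)) = 0) :
    ∃ H, f = C (p : ℤ) * H := by
  refine (C_dvd_iff_dvd_coeff _ _).mpr fun i => ?_
  have := congrArg (fun g => coeff g i) h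
  rwa [coeff_map, coeff_zero, eq_intCast, ZMod.intCast_zmod_eq_zero_iff_dvd] at this

theorem isIntegral_aeval {S : Type*} [CommRing S] {x : S} (hx : IsIntegral ℤ x) (Q : ℤ[X]) :
    IsIntegral ℤ (aeval x Q) :=
  (integralClosure ℤ S).aeval_coe ⟨x, hx⟩ Q ▸ (aeval (⟨x, hx⟩ : integralClosure ℤ S) Q).2

/-- Every factor of `x ^ s + B` modulo `p` almost vanishes at some root of `x ^ s + B`. -/
theorem exists_root_of_factor [IsAlgClosed Ω] (hΩ : ‖(p : Ω)‖ < 1) (hs0 : s ≠ 0)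
    {Q : ℤ[X]} (hQ : Q.Monic) (hQ0 : Q.natDegree ≠ 0)
    (hdvd : Q.map (Int.castRingHom (ZMod p)) ∣ X ^ s + C (B : ZMod p)) :
    ∃ ζ : Ω, ζ ^ s = -(B : Ω) ∧ ‖aeval ζ Q‖ < 1 := by
  obtain ⟨q', hq'⟩ := hdvd
  obtain ⟨Q', rfl⟩ := map_surjective (Int.castRingHom (ZMod p))
    (ZMod.ringHom_surjective _) q'
  obtain ⟨H, hH⟩ := exists_C_mul_of_map_eq_zero (p := p) (f := X ^ s + C B - Q * Q') (by
    rw [Polynomial.map_sub, Polynomial.map_mul, ← hq']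
    simp)
  obtain ⟨β, hβ⟩ := IsAlgClosed.exists_root (Q.map (algebraMap ℤ Ω)) (by
    rw [hQ.degree_map, degree_eq_natDegree hQ.ne_zero]
    exact_mod_cast hQ0)
  rw [IsRoot, eval_map_algebraMap] at hβ
  have hβi : IsIntegral ℤ β := ⟨Q, hQ, by rwa [← aeval_def]⟩
  -- At a root β of `Q` the polynomial x^s + B takes a value divisible by p.
  have hsmall : ‖β ^ s + (B : Ω)‖ < 1 := by
    have := congrArg (aeval β) hH
    simp only [map_sub, map_mul, hβ, zero_mul, sub_zero, map_add, map_pow, aeval_X, aeval_C] at this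
    have e : β ^ s + (B : Ω) = (p : Ω) * aeval β H := by simpa using this
    rw [e, norm_mul]
    exact (mul_le_of_le_one_right (norm_nonneg _)
      (norm_le_one_of_isIntegral (isIntegral_aeval hβi H))).trans_lt hΩ
  have hmonic : (X ^ s + C (B : Ω)).Monic := monic_X_pow_add_C _ hs0
  have hprod := (IsAlgClosed.splits (X ^ s + C (B : Ω))).eq_prod_roots_of_monic hmonic
  have hroot : ∀ ζ ∈ (X ^ s + C (B : Ω)).roots, ζ ^ s = -(B : Ω) := by
    intro ζ hζ
    have := isRoot_of_mem_roots hζ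
    rw [IsRoot, eval_add, eval_pow, eval_X, eval_C] at this
    exact eq_neg_of_add_eq_zero_left this
  -- The distances from β to the roots of x^s + B multiply to |β^s + B| < 1, so one of them is below
  -- 1.
  obtain ⟨ζ, hζ, hζβ⟩ : ∃ ζ ∈ (X ^ s + C (B : Ω)).roots, ‖β - ζ‖ < 1 := by
    by_contra! h
    have e := congrArg (fun f => ‖eval β f‖) hprod
    simp only [eval_add, eval_pow, eval_X, eval_C, eval_multiset_prod, Multiset.map_map,
      Function.comp_apply, eval_sub] at e
    rw [e] at hsmall
    refine absurd hsmall (not_lt.mpr ?_)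
    generalize (X ^ s + C (B : Ω)).roots = M at h
    induction M using Multiset.induction_on with
    | empty => simp
    | cons ζ M ih =>
      rw [Multiset.map_cons, Multiset.prod_cons, norm_mul]
      exact one_le_mul_of_one_le_of_one_le (h ζ (Multiset.mem_cons_self _ _))
        (ih fun x hx => h x (Multiset.mem_cons_of_mem hx))
  refine ⟨ζ, hroot ζ hζ, ?_⟩
  have hζi : IsIntegral ℤ ζ := by
    refine ⟨X ^ s + C B, monic_X_pow_add_C _ hs0, ?_⟩
    rw [eval₂_add, eval₂_X_pow, eval₂_C, hroot ζ hζ]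
    simp
  have := norm_aeval_sub_le hβi hζi Q
  rw [hβ, zero_sub, norm_neg] at this
  exact this.trans_lt hζβ

end trinomial

/-! ### Factors of x^s + b modulo p -/

section factors

open UniqueFactorizationMonoid

variable {p : ℕ} [hp : Fact p.Prime]

/-- x^s + b is separable modulo p, so each irreducible factor occurs once. -/
theorem sum_natDegree_factors {s : ℕ} (hs : ¬ p ∣ s) {b : ZMod p} (hb : b ≠ 0) :
    ∑ q ∈ (normalizedFactors (X ^ s + C b)).toFinset, q.natDegree = s := by
  have hs0 : s ≠ 0 := by rintro rfl; simp at hs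
  have hm : (X ^ s + C b).Monic := monic_X_pow_add_C b hs0
  have hsep : (X ^ s + C b).Separable := by
    have := (Polynomial.separable_X_pow_sub_C (F := ZMod p) (n := s) (-b)
      (by rwa [Ne, ZMod.natCast_eq_zero_iff]) (neg_ne_zero.mpr hb))
    rwa [C_neg, sub_neg_eq_add] at this
  have hnd : (normalizedFactors (X ^ s + C b)).Nodup :=
    (squarefree_iff_nodup_normalizedFactors hm.ne_zero).mp hsep.squarefree
  have hprod := prod_normalizedFactors_eq hm.ne_zero
  rw [hm.normalize_eq_self] at hprod
  have hdeg := natDegree_multiset_prod_of_monic (normalizedFactors (X ^ s + C b)) fun q hq =>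
    ((Polynomial.mem_normalizedFactors_iff hm.ne_zero).mp hq).2.1
  rw [hprod, natDegree_X_pow_add_C] at hdeg
  rw [Finset.sum, Multiset.toFinset_val, hnd.dedup]
  exact hdeg.symm

theorem numIrreducibleFactors_eq_card {s : ℕ} (hs0 : s ≠ 0) (f : ℕ) (B : ℤ) :
    numIrreducibleFactors p f s B =
      {q ∈ (normalizedFactors (X ^ s + C (B : ZMod p))).toFinset | q.natDegree = f}.card := by
  have hm : (X ^ s + C (B : ZMod p)).Monic := monic_X_pow_add_C _ hs0
  rw [numIrreducibleFactors, ← Set.ncard_coe_finset]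
  congr 1
  ext q
  simp only [Set.mem_ofPred_eq, Finset.coe_filter, Multiset.mem_toFinset,
    Polynomial.mem_normalizedFactors_iff hm.ne_zero]
  tauto

/-- This recovers the factor q from the prime P alone and bounds the residue degree of P from below.
-/
theorem minpoly_residue {R : Type*} [CommRing R] {P : Ideal R} [P.IsPrime] [CharP (R ⧸ P) p]
    {x : R} {Q : ℤ[X]} (hm : (Q.map (Int.castRingHom (ZMod p))).Monic)
    (hirr : Irreducible (Q.map (Int.castRingHom (ZMod p)))) (hQ : aeval x Q ∈ P) :
    letI := ZMod.algebra (R ⧸ P) p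
    Q.map (Int.castRingHom (ZMod p)) = minpoly (ZMod p) (Ideal.Quotient.mk P x) := by
  let := ZMod.algebra (R ⧸ P) p
  refine minpoly.eq_of_irreducible_of_monic hirr ?_ hm
  rw [← Ideal.Quotient.eq_zero_iff_mem, aeval_def, hom_eval₂] at hQ
  rw [aeval_def, eval₂_map, ← hQ]
  congr 1
  exact Subsingleton.elim _ _

end factors

/-! ### Residue degrees, ramification and embeddings -/

section primes

variable {K : Type*} [Field K] [NumberField K] {p : ℕ} [hp : Fact p.Prime]

theorem charP_quotient {R : Type*} [CommRing R] {p : ℕ} {P : Ideal R}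
    (hP : P ∈ Ideal.primesOver (Ideal.span {(p : ℤ)}) R) : CharP (R ⧸ P) p := by
  have := hP.1
  have := hP.2
  refine ⟨fun x => ?_⟩
  rw [← map_natCast (Ideal.Quotient.mk P), Ideal.Quotient.eq_zero_iff_mem,
    ← Int.natCast_dvd_natCast, ← Ideal.mem_span_singleton, Ideal.over_def P (Ideal.span {(p : ℤ)}),
    Ideal.under_def, Ideal.mem_comap]
  simp

theorem natDegree_le_inertiaDeg {P : Ideal (𝓞 K)}
    (hP : P ∈ Ideal.primesOver (Ideal.span {(p : ℤ)}) (𝓞 K)) {x : 𝓞 K} {Q : ℤ[X]}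
    (hm : (Q.map (Int.castRingHom (ZMod p))).Monic)
    (hirr : Irreducible (Q.map (Int.castRingHom (ZMod p)))) (hQ : aeval x Q ∈ P) :
    (Q.map (Int.castRingHom (ZMod p))).natDegree ≤ P.inertiaDeg ℤ := by
  have := hP.1
  have := hP.2
  have := charP_quotient hP
  have hP0 : P ≠ ⊥ := Ideal.ne_bot_of_mem_primesOver (by simp [hp.out.ne_zero]) hP
  have : P.IsMaximal := Ring.DimensionLEOne.maximalOfPrime hP0 hP.1
  let : Field (𝓞 K ⧸ P) := Ideal.Quotient.field P
  let := ZMod.algebra (𝓞 K ⧸ P) p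
  have : Finite (𝓞 K ⧸ P) := Ideal.finiteQuotientOfFreeOfNeBot P hP0
  have : Module.Finite (ZMod p) (𝓞 K ⧸ P) := Module.Finite.of_finite
  have h1 := Module.natCard_eq_pow_finrank (K := ZMod p) (V := 𝓞 K ⧸ P)
  have h2 := Ideal.pow_inertiaDeg p P
  rw [Ideal.absNorm_apply, Submodule.cardQuot_apply, h1, Nat.card_zmod] at h2
  rw [Nat.pow_right_injective hp.out.two_le h2, minpoly_residue hm hirr hQ]
  exact minpoly.natDegree_le _

theorem sum_ramificationIdx_mul_inertiaDeg_le
    (T : Finset (Ideal (𝓞 K)))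
    (hT : ∀ P ∈ T, P ∈ Ideal.primesOver (Ideal.span {(p : ℤ)}) (𝓞 K)) :
    ∑ P ∈ T, P.ramificationIdx ℤ * P.inertiaDeg ℤ ≤ Module.finrank ℚ K := by
  have hpm : (Ideal.span {(p : ℤ)}).IsMaximal := Int.ideal_span_isMaximal_of_prime p
  have hfin := IsDedekindDomain.primesOver_finite (Ideal.span {(p : ℤ)}) (𝓞 K)
  let := hfin.fintype
  have h := Ideal.sum_ramification_inertia_eq_finrank (Ideal.span {(p : ℤ)}) (𝓞 K)
  rw [RingOfIntegers.rank] at h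
  rw [← h, Finset.sum_set_coe (Ideal.primesOver (Ideal.span {(p : ℤ)}) (𝓞 K))
    (f := fun P => P.ramificationIdx ℤ * P.inertiaDeg ℤ)]
  exact Finset.sum_le_sum_of_subset fun P hP => Set.mem_toFinset.mpr (hT P hP)

theorem ramificationIdx_eq_multiplicity_span {P : Ideal (𝓞 K)}
    (hP : P ∈ Ideal.primesOver (Ideal.span {(p : ℤ)}) (𝓞 K)) :
    P.ramificationIdx ℤ = multiplicity P (Ideal.span {(p : 𝓞 K)}) := by
  have := hP.1
  have := hP.2
  have hmap : (Ideal.span {(p : ℤ)}).map (algebraMap ℤ (𝓞 K)) = Ideal.span {(p : 𝓞 K)} := by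
    rw [Ideal.map_span, Set.image_singleton, map_natCast]
  rw [Ideal.IsDedekindDomain.ramificationIdx_eq_multiplicity (Ideal.span {(p : ℤ)}), hmap]
  rw [hmap]
  simp [hp.out.ne_zero]

theorem norm_natCast_padicAlgCl : ‖(p : PadicAlgCl p)‖ = (p : ℝ)⁻¹ := by
  rw [← map_natCast (algebraMap ℚ_[p] (PadicAlgCl p)), ← Padic.norm_p]
  exact PadicAlgCl.norm_extends p _

variable {A B : ℤ} {n m : ℕ} {θ : K}

theorem minpoly_eq_trinomial (hmn : m < n)
    (hF : Irreducible (X ^ n + C A * X ^ m + C B : ℤ[X]))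
    (hθ : aeval θ (X ^ n + C A * X ^ m + C B : ℤ[X]) = 0) :
    minpoly ℚ θ = X ^ n + C (A : ℚ) * X ^ m + C (B : ℚ) := by
  have hdeg : (C A * X ^ m + C B : ℤ[X]).degree < n := by
    refine (degree_add_le _ _).trans_lt (max_lt ?_ ?_)
    · exact (degree_C_mul_X_pow_le m _).trans_lt (by exact_mod_cast hmn)
    · exact degree_C_le.trans_lt (by exact_mod_cast Nat.zero_lt_of_lt hmn)
  have hFm : (X ^ n + C A * X ^ m + C B : ℤ[X]).Monic := by
    rw [add_assoc]
    exact monic_X_pow_add hdeg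
  have h := minpoly.eq_of_irreducible_of_monic
    ((hFm.irreducible_iff_irreducible_map_fraction_map (K := ℚ)).mp hF) (x := θ)
    (by rwa [aeval_map_algebraMap]) (hFm.map _)
  rw [← h]
  simp

theorem finrank_eq_of_trinomial (hmn : m < n)
    (hF : Irreducible (X ^ n + C A * X ^ m + C B : ℤ[X]))
    (hθ : aeval θ (X ^ n + C A * X ^ m + C B : ℤ[X]) = 0)
    (hK : IntermediateField.adjoin ℚ {θ} = ⊤) : Module.finrank ℚ K = n := by
  rw [← (Field.primitive_element_iff_minpoly_natDegree_eq ℚ θ).mp hK,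
    minpoly_eq_trinomial hmn hF hθ, add_assoc]
  refine natDegree_eq_of_degree_eq_some ?_
  rw [degree_add_eq_left_of_degree_lt, degree_X_pow]
  rw [degree_X_pow]
  refine (degree_add_le _ _).trans_lt (max_lt ?_ ?_)
  · exact (degree_C_mul_X_pow_le m _).trans_lt (by exact_mod_cast hmn)
  · exact degree_C_le.trans_lt (by exact_mod_cast Nat.zero_lt_of_lt hmn)

theorem exists_embedding (hmn : m < n)
    (hF : Irreducible (X ^ n + C A * X ^ m + C B : ℤ[X]))
    (hθ : aeval θ (X ^ n + C A * X ^ m + C B : ℤ[X]) = 0)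
    {Ω : Type*} [Field Ω] [IsAlgClosed Ω] [CharZero Ω] {w : Ω}
    (hw : w ^ n + A * w ^ m + B = 0) : ∃ σ : K →+* Ω, σ θ = w := by
  have hmem : w ∈ (minpoly ℚ θ).rootSet Ω := by
    rw [mem_rootSet, minpoly_eq_trinomial hmn hF hθ]
    refine ⟨?_, by simpa using hw⟩
    rw [← minpoly_eq_trinomial hmn hF hθ]
    exact minpoly.ne_zero (Algebra.IsIntegral.isIntegral θ)
  rw [← Algebra.IsAlgebraic.range_eval_eq_rootSet_minpoly] at hmem
  obtain ⟨σ, hσ⟩ := hmem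
  exact ⟨σ.toRingHom, hσ⟩

end primes

/-! ### Counting primes of given residue degree -/

section counting

open UniqueFactorizationMonoid

variable {K : Type*} [Field K] [NumberField K] {p : ℕ} [hp : Fact p.Prime]
  {A B : ℤ} {n m s a k : ℕ} {θ : 𝓞 K}

/-- For each irreducible factor `q` of `x ^ s + B` modulo `p` and each side of the Newton polygon,
there is a prime ideal above `p` whose residue degree and ramification index are at least the
degree of `q` and the length of the side. -/
theorem exists_prime_of_factor (hp2 : 2 < p) (hmn : m < n)
    (hF : Irreducible (X ^ n + C A * X ^ m + C B : ℤ[X]))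
    (hθ : aeval (θ : K) (X ^ n + C A * X ^ m + C B : ℤ[X]) = 0)
    (hs : ¬ p ∣ s) (hn : n = s * p ^ (a + k)) (hB : ¬ (p : ℤ) ∣ B)
    (hA : ‖(A : PadicAlgCl p)‖ ≤ ‖(p : PadicAlgCl p)‖ ^ (k + 1))
    (hB' : ‖((B - B ^ p ^ (a + k) : ℤ) : PadicAlgCl p)‖ ≤ ‖(p : PadicAlgCl p)‖ ^ (k + 1))
    (hAB : a = 0 ∨ (‖(A : PadicAlgCl p)‖ = ‖(p : PadicAlgCl p)‖ ^ (k + 1) ∧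
        ‖((B - B ^ p ^ (a + k) : ℤ) : PadicAlgCl p)‖ < ‖(p : PadicAlgCl p)‖ ^ (k + 1)) ∨
      (‖(A : PadicAlgCl p)‖ < ‖(p : PadicAlgCl p)‖ ^ (k + 1) ∧
        ‖((B - B ^ p ^ (a + k) : ℤ) : PadicAlgCl p)‖ = ‖(p : PadicAlgCl p)‖ ^ (k + 1)))
    {q : (ZMod p)[X]} (hqm : q.Monic) (hq : Irreducible q)
    (hqd : q ∣ X ^ s + C (B : ZMod p)) {i : ℕ} (hi : i ≤ k) :
    ∃ P : Ideal (𝓞 K), P ∈ Ideal.primesOver (Ideal.span {(p : ℤ)}) (𝓞 K) ∧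
      sideLength p a i ≤ P.ramificationIdx ℤ ∧ q.natDegree ≤ P.inertiaDeg ℤ ∧
      (∃ (τ : 𝓞 K →+* PadicAlgCl p) (hτ : ∀ x, ‖τ x‖ ≤ 1), P = normIdeal τ hτ ∧
        HasSlope ‖(p : PadicAlgCl p)‖ ‖τ (θ ^ s + B)‖ (sideLength p a i)) ∧
      ∃ Q : ℤ[X], Q.map (Int.castRingHom (ZMod p)) = q ∧ aeval θ Q ∈ P := by
  have hp1 : 1 < p := by omega
  have hΩ : ‖(p : PadicAlgCl p)‖ < 1 := by
    rw [norm_natCast_padicAlgCl]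
    exact inv_lt_one_of_one_lt₀ (by exact_mod_cast hp1)
  have hp0 : (p : PadicAlgCl p) ≠ 0 := Nat.cast_ne_zero.mpr hp.out.ne_zero
  have hs0 : s ≠ 0 := by rintro rfl; simp at hs
  obtain ⟨Q, rfl, hQdeg, hQm⟩ := lifts_and_natDegree_eq_and_monic (f := Int.castRingHom (ZMod p))
    ((mem_lifts q).mpr (map_surjective _ (ZMod.ringHom_surjective _) q)) hqm
  obtain ⟨ζ, hζ, hQζ⟩ := exists_root_of_factor hΩ hs0 hQm
    (by rw [hQdeg]; exact hq.natDegree_pos.ne') hqd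
  obtain ⟨w, hw, hslope⟩ := exists_root_trinomial hΩ hp0 hp2 hmn hs hn hB hζ hA hB' hAB hi
  obtain ⟨σ, hσ⟩ := exists_embedding hmn hF hθ hw
  have hwi : IsIntegral ℤ w := hσ ▸ map_isIntegral_int σ θ.isIntegral_coe
  have hζi : IsIntegral ℤ ζ := by
    refine ⟨X ^ s + C B, monic_X_pow_add_C _ hs0, ?_⟩
    rw [eval₂_add, eval₂_X_pow, eval₂_C, hζ]
    simp
  have hζ1 : ‖ζ‖ = 1 := by
    rw [← pow_eq_one_iff_of_nonneg (norm_nonneg _) hs0, ← norm_pow, hζ, norm_neg,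
      norm_intCast_eq_one hp.out hΩ hB]
  set τ : 𝓞 K →+* PadicAlgCl p := σ.comp (algebraMap (𝓞 K) K) with hτdef
  have hτθ : τ θ = w := hσ
  have hτi : Function.Injective τ := σ.injective.comp RingOfIntegers.coe_injective
  have hτ : ∀ x, ‖τ x‖ ≤ 1 := fun x =>
    norm_le_one_of_isIntegral (map_isIntegral_int σ x.isIntegral_coe)
  have hwζ : ‖w - ζ‖ < 1 := hslope.lt_one hΩ
  -- θ^s + B replaces w - ζ, since ζ need not lie in the image of K.
  have hy : ‖τ (θ ^ s + B)‖ = ‖w - ζ‖ := by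
    rw [← norm_pow_sub_pow_eq hΩ hs hwi hζi hζ1 hwζ, map_add, map_pow, hτθ, map_intCast, hζ,
      sub_neg_eq_add]
  have hPQ : aeval θ Q ∈ normIdeal τ hτ := by
    have e : τ (aeval θ Q) = aeval w Q := by
      rw [← hτθ]
      exact (aeval_algHom_apply τ.toIntAlgHom θ Q).symm
    rw [mem_normIdeal, e, ← sub_add_cancel (aeval w Q) (aeval ζ Q)]
    exact (IsUltrametricDist.norm_add_le_max _ _).trans_lt
      (max_lt ((norm_aeval_sub_le hwi hζi Q).trans_lt hwζ) hQζ)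
  have hP : normIdeal τ hτ ∈ Ideal.primesOver (Ideal.span {(p : ℤ)}) (𝓞 K) :=
    ⟨inferInstance, normIdeal_liesOver hp.out hΩ τ hτ⟩
  rw [← hy] at hslope
  refine ⟨normIdeal τ hτ, hP, ?_, natDegree_le_inertiaDeg hP hqm hq hPQ, ⟨τ, hτ, rfl, hslope⟩,
    Q, rfl, hPQ⟩
  rcases hslope with h | ⟨h, -⟩
  · rw [ramificationIdx_eq_multiplicity_span hP]
    exact le_multiplicity_of_norm_pow_eq hΩ hp0 hτi h
  -- A steeper side has length one, and ramification indices are positive.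
  · rw [h]
    have := hP.1
    exact Ideal.ramificationIdx_pos _ _

theorem exists_primes_of_inertiaDeg (hp2 : 2 < p) (hmn : m < n)
    (hF : Irreducible (X ^ n + C A * X ^ m + C B : ℤ[X]))
    (hθ : aeval (θ : K) (X ^ n + C A * X ^ m + C B : ℤ[X]) = 0)
    (hK : IntermediateField.adjoin ℚ {(θ : K)} = ⊤)
    (hs : ¬ p ∣ s) (hn : n = s * p ^ (a + k)) (hB : ¬ (p : ℤ) ∣ B)
    (hA : ‖(A : PadicAlgCl p)‖ ≤ ‖(p : PadicAlgCl p)‖ ^ (k + 1))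
    (hB' : ‖((B - B ^ p ^ (a + k) : ℤ) : PadicAlgCl p)‖ ≤ ‖(p : PadicAlgCl p)‖ ^ (k + 1))
    (hAB : a = 0 ∨ (‖(A : PadicAlgCl p)‖ = ‖(p : PadicAlgCl p)‖ ^ (k + 1) ∧
        ‖((B - B ^ p ^ (a + k) : ℤ) : PadicAlgCl p)‖ < ‖(p : PadicAlgCl p)‖ ^ (k + 1)) ∨
      (‖(A : PadicAlgCl p)‖ < ‖(p : PadicAlgCl p)‖ ^ (k + 1) ∧
        ‖((B - B ^ p ^ (a + k) : ℤ) : PadicAlgCl p)‖ = ‖(p : PadicAlgCl p)‖ ^ (k + 1))) (f : ℕ) :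
    ∃ T : Finset (Ideal (𝓞 K)), T.card = (k + 1) * numIrreducibleFactors p f s B ∧
      ∀ P ∈ T, P ∈ Ideal.primesOver (Ideal.span {(p : ℤ)}) (𝓞 K) ∧ P.inertiaDeg ℤ = f := by
  classical
  have hp1 : 1 < p := by omega
  have hΩ : ‖(p : PadicAlgCl p)‖ < 1 := by
    rw [norm_natCast_padicAlgCl]
    exact inv_lt_one_of_one_lt₀ (by exact_mod_cast hp1)
  have hp0 : (p : PadicAlgCl p) ≠ 0 := Nat.cast_ne_zero.mpr hp.out.ne_zero
  have hs0 : s ≠ 0 := by rintro rfl; simp at hs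
  set S := (normalizedFactors (X ^ s + C (B : ZMod p))).toFinset with hS
  have hSmem : ∀ q ∈ S, Irreducible q ∧ q.Monic ∧ q ∣ X ^ s + C (B : ZMod p) := fun q hq =>
    (Polynomial.mem_normalizedFactors_iff (monic_X_pow_add_C _ hs0).ne_zero).mp
      (Multiset.mem_toFinset.mp hq)
  have hex : ∀ x ∈ S ×ˢ Finset.range (k + 1), _ := fun x hx =>
    have hx' := Finset.mem_product.mp hx
    have hx1 := hSmem x.1 hx'.1
    exists_prime_of_factor hp2 hmn hF hθ hs hn hB hA hB' hAB hx1.2.1 hx1.1 hx1.2.2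
      (Nat.lt_succ_iff.mp (Finset.mem_range.mp hx'.2))
  choose! P hPover hPe hPf hPτ hPQ using hex
  have hinj : Set.InjOn P (S ×ˢ Finset.range (k + 1) : Finset _) := by
    intro x hx y hy hxy
    have hx' := hSmem x.1 (Finset.mem_product.mp hx).1
    have hy' := hSmem y.1 (Finset.mem_product.mp hy).1
    refine Prod.ext ?_ ?_
    · obtain ⟨Q, hQ, hQP⟩ := hPQ x hx
      obtain ⟨Q', hQ', hQP'⟩ := hPQ y hy
      rw [← hxy] at hQP'
      have := (hPover x hx).1
      have := charP_quotient (hPover x hx)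
      rw [← hQ, ← hQ', minpoly_residue (hQ ▸ hx'.2.1) (hQ ▸ hx'.1) hQP,
        minpoly_residue (hQ' ▸ hy'.2.1) (hQ' ▸ hy'.1) hQP']
    -- The norm of θ^s + B depends only on P, not on the embedding, and fixes the side length.
    · obtain ⟨τ, hτ, hτP, hτs⟩ := hPτ x hx
      obtain ⟨υ, hυ, hυP, hυs⟩ := hPτ y hy
      rw [norm_eq_of_normIdeal_eq hΩ hp0 (hτP.symm.trans (hxy.trans hυP))] at hτs
      exact (sideLength_strictMono hp2 a).injective (hτs.unique (norm_pos_iff.mpr hp0) hΩ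
        (norm_nonneg _) (sideLength_pos hp1 a _).ne' (sideLength_pos hp1 a _).ne' hυs)
  have hterm : ∀ x ∈ S ×ˢ Finset.range (k + 1),
      sideLength p a x.2 * x.1.natDegree ≤ (P x).ramificationIdx ℤ * (P x).inertiaDeg ℤ :=
    fun x hx => Nat.mul_le_mul (hPe x hx) (hPf x hx)
  have hsum1 : ∑ x ∈ S ×ˢ Finset.range (k + 1), sideLength p a x.2 * x.1.natDegree = n := by
    rw [Finset.sum_product]
    simp only [← Finset.sum_mul, sum_sideLength hp.out.pos]
    rw [← Finset.mul_sum, hS, sum_natDegree_factors hs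
      (by rwa [Ne, ZMod.intCast_zmod_eq_zero_iff_dvd]),
      hn, mul_comm]
  have hsum2 : ∑ x ∈ S ×ˢ Finset.range (k + 1),
      (P x).ramificationIdx ℤ * (P x).inertiaDeg ℤ ≤ n := by
    rw [← finrank_eq_of_trinomial hmn hF hθ hK, ← Finset.sum_image (g := P)
      (f := fun P => P.ramificationIdx ℤ * P.inertiaDeg ℤ) hinj]
    refine sum_ramificationIdx_mul_inertiaDeg_le (p := p) _ fun P' hP' => ?_
    obtain ⟨x, hx, rfl⟩ := Finset.mem_image.mp hP'
    exact hPover x hx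
  -- Both sums are squeezed to n, so each termwise inequality is an equality.
  have heq := (Finset.sum_eq_sum_iff_of_le hterm).mp
    (le_antisymm (Finset.sum_le_sum hterm) (hsum2.trans hsum1.ge))
  have hf : ∀ x ∈ S ×ˢ Finset.range (k + 1), (P x).inertiaDeg ℤ = x.1.natDegree := by
    intro x hx
    refine le_antisymm ?_ (hPf x hx)
    refine Nat.le_of_mul_le_mul_left ?_ (sideLength_pos hp1 a x.2)
    rw [heq x hx]
    exact Nat.mul_le_mul_right _ (hPe x hx)
  have hsub : {q ∈ S | q.natDegree = f} ×ˢ Finset.range (k + 1) ⊆ S ×ˢ Finset.range (k + 1) :=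
    Finset.product_subset_product_left (Finset.filter_subset _ _)
  refine ⟨({q ∈ S | q.natDegree = f} ×ˢ Finset.range (k + 1)).image P, ?_, ?_⟩
  · rw [Finset.card_image_of_injOn (hinj.mono (Finset.coe_subset.mpr hsub)), Finset.card_product,
      Finset.card_range, numIrreducibleFactors_eq_card hs0, mul_comm]
  · intro P' hP'
    obtain ⟨x, hx, rfl⟩ := Finset.mem_image.mp hP'
    refine ⟨hPover x (hsub hx), ?_⟩
    rw [hf x (hsub hx)]
    exact (Finset.mem_filter.mp (Finset.mem_product.mp hx).1).2

theorem dvd_fieldIndex_of_numIrreducible_lt (hp2 : 2 < p) (hmn : m < n)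
    (hF : Irreducible (X ^ n + C A * X ^ m + C B : ℤ[X]))
    (hθ : aeval (θ : K) (X ^ n + C A * X ^ m + C B : ℤ[X]) = 0)
    (hK : IntermediateField.adjoin ℚ {(θ : K)} = ⊤)
    (hs : ¬ p ∣ s) (hn : n = s * p ^ (a + k)) (hB : ¬ (p : ℤ) ∣ B)
    (hA : ((k + 1 : ℕ) : ℕ∞) ≤ emultiplicity (p : ℤ) A)
    (hB' : ((k + 1 : ℕ) : ℕ∞) ≤ emultiplicity (p : ℤ) (B - B ^ p ^ (a + k)))
    (hAB : a = 0 ∨ (emultiplicity (p : ℤ) A = (k + 1 : ℕ) ∧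
        ((k + 1 : ℕ) : ℕ∞) < emultiplicity (p : ℤ) (B - B ^ p ^ (a + k))) ∨
      (((k + 1 : ℕ) : ℕ∞) < emultiplicity (p : ℤ) A ∧
        emultiplicity (p : ℤ) (B - B ^ p ^ (a + k)) = (k + 1 : ℕ))) {f : ℕ}
    (h : numIrreducible p f < (k + 1) * numIrreducibleFactors p f s B) :
    p ∣ fieldIndex K := by
  have hp1 : 1 < p := by omega
  have hΩ : ‖(p : PadicAlgCl p)‖ < 1 := by
    rw [norm_natCast_padicAlgCl]
    exact inv_lt_one_of_one_lt₀ (by exact_mod_cast hp1)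
  have hp0 : 0 < ‖(p : PadicAlgCl p)‖ := norm_pos_iff.mpr (Nat.cast_ne_zero.mpr hp.out.ne_zero)
  have hle : ∀ {z : ℤ} {e : ℕ}, (e : ℕ∞) ≤ emultiplicity (p : ℤ) z →
      ‖(z : PadicAlgCl p)‖ ≤ ‖(p : PadicAlgCl p)‖ ^ e := fun h =>
    norm_intCast_le_pow (pow_dvd_of_le_emultiplicity h)
  have hlt : ∀ {z : ℤ} {e : ℕ}, (e : ℕ∞) < emultiplicity (p : ℤ) z →
      ‖(z : PadicAlgCl p)‖ < ‖(p : PadicAlgCl p)‖ ^ e := fun {z e} h =>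
    (hle (e := e + 1) (by push_cast; exact Order.add_one_le_of_lt h)).trans_lt
      (pow_lt_pow_right_of_lt_one₀ hp0 hΩ (Nat.lt_succ_self e))
  obtain ⟨T, hTcard, hT⟩ := exists_primes_of_inertiaDeg hp2 hmn hF hθ hK hs hn hB (hle hA)
    (hle hB') (hAB.imp_right (Or.imp (fun h => ⟨norm_intCast_eq_pow hΩ h.1, hlt h.2⟩)
      fun h => ⟨hlt h.1, norm_intCast_eq_pow hΩ h.2⟩)) f
  rw [dvd_fieldIndex_iff]
  intro α _
  by_contra hα
  have := card_le_numIrreducible hα T hT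
  omega

end counting

/-! ### The three cases -/

theorem lemma2p1 (K : Type*) [Field K] [NumberField K]
    (n m : ℕ) (hmn : m < n) (a b : ℤ)
    (hF : Irreducible (X ^ n + C a * X ^ m + C b : ℤ[X]))
    (θ : K) (hθ : aeval θ (X ^ n + C a * X ^ m + C b : ℤ[X]) = 0)
    (hK : IntermediateField.adjoin ℚ {θ} = ⊤)
    (p : ℕ) (hp : p.Prime) (hp_odd : p ≠ 2)
    (hpa : (p : ℤ) ∣ a) (hpn : p ∣ n) (hpb : ¬ (p : ℤ) ∣ b)
    (μ ν : ℕ∞) (hμ : μ = emultiplicity (p : ℤ) a)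
    (hν : ν = emultiplicity (p : ℤ) (b ^ (p - 1) - 1))
    (s r : ℕ) (hn : n = s * p ^ r) (hs : ¬ p ∣ s)
    (f : ℕ) (hf : 0 < f)
    (h : (μ < min ν (r + 1) ∧
            (numIrreducible p f : ℕ∞) < μ * numIrreducibleFactors p f s b) ∨
         (ν < min μ (r + 1) ∧
            (numIrreducible p f : ℕ∞) < ν * numIrreducibleFactors p f s b) ∨
         ((r + 1 : ℕ∞) ≤ min ν μ ∧
            numIrreducible p f < (r + 1) * numIrreducibleFactors p f s b)) :
    p ∣ fieldIndex K ∧ ¬ IsMonogenicField K := by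
  have hfact : Fact p.Prime := ⟨hp⟩
  have hp2 : 2 < p := lt_of_le_of_ne hp.two_le hp_odd.symm
  have hr : r ≠ 0 := by
    rintro rfl
    rw [pow_zero, mul_one] at hn
    exact hs (hn ▸ hpn)
  rw [← emultiplicity_pow_prime_pow_sub_self hpb hr] at hν
  have hθi : IsIntegral ℤ θ := by
    refine ⟨X ^ n + C a * X ^ m + C b, ?_, by rwa [← aeval_def]⟩
    rw [add_assoc]
    refine monic_X_pow_add ((degree_add_le _ _).trans_lt (max_lt ?_ ?_))
    · exact (degree_C_mul_X_pow_le m _).trans_lt (by exact_mod_cast hmn)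
    · exact degree_C_le.trans_lt (by exact_mod_cast Nat.zero_lt_of_lt hmn)
  obtain ⟨θ, rfl⟩ : ∃ θ' : 𝓞 K, (θ' : K) = θ := ⟨⟨θ, hθi⟩, rfl⟩
  suffices hdvd : p ∣ fieldIndex K from ⟨hdvd, not_isMonogenicField_of_dvd_fieldIndex hp hdvd⟩
  have hside : ∀ {e : ℕ}, ((e : ℕ) : ℕ∞) < (r + 1 : ℕ∞) →
      (numIrreducible p f : ℕ∞) < (e : ℕ∞) * numIrreducibleFactors p f s b →
      ∃ c k, r = c + k ∧ e = k + 1 ∧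
        numIrreducible p f < (k + 1) * numIrreducibleFactors p f s b := by
    intro e he hlt
    have he' : e < r + 1 := by exact_mod_cast he
    have hlt' : numIrreducible p f < e * numIrreducibleFactors p f s b := by exact_mod_cast hlt
    -- The strict inequality excludes e = 0; the first side then has length p^(r-k).
    rcases e with _ | k
    · simp at hlt'
    · exact ⟨r - k, k, by omega, rfl, hlt'⟩
  rcases h with ⟨h1, h2⟩ | ⟨h1, h2⟩ | ⟨h1, h2⟩
  · obtain ⟨h5, h3⟩ := lt_min_iff.mp h1
    obtain ⟨e, rfl⟩ := ENat.ne_top_iff_exists.mp h5.ne_top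
    obtain ⟨c, k, rfl, rfl, h4⟩ := hside h3 h2
    exact dvd_fieldIndex_of_numIrreducible_lt hp2 hmn hF hθ hK hs hn hpb hμ.le
      (hν ▸ h5.le) (Or.inr (Or.inl ⟨hμ.symm, hν ▸ h5⟩)) h4
  · obtain ⟨h5, h3⟩ := lt_min_iff.mp h1
    obtain ⟨e, rfl⟩ := ENat.ne_top_iff_exists.mp h5.ne_top
    obtain ⟨c, k, rfl, rfl, h4⟩ := hside h3 h2
    exact dvd_fieldIndex_of_numIrreducible_lt hp2 hmn hF hθ hK hs hn hpb (hμ ▸ h5.le)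
      hν.le (Or.inr (Or.inr ⟨hμ ▸ h5, hν.symm⟩)) h4
  · obtain ⟨h1, h3⟩ := le_min_iff.mp h1
    -- Here k = r and the first side has length one, so lower bounds for both valuations suffice.
    rw [← zero_add r] at hν hn
    exact dvd_fieldIndex_of_numIrreducible_lt hp2 hmn hF hθ hK hs hn hpb
      (by push_cast; exact hμ ▸ h3) (by push_cast; exact hν ▸ h1) (Or.inl rfl) h2
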